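/- Let $n\ge 0$ and let $x_0<x_1<\dots<x_{n+1}$, $\sigma_1,\dots,\sigma_{n+1}>0$ and $\beta_1,\dots,\beta_4\in\mathbb R$ with $(\beta_1,\beta_2)\ne(0,0)$ and $(\beta_3,\beta_4)\neq(0,0)$. Consider the heat problem in $n+1$ layers in perfect thermal contact: for $t>0$, $$u^{(j)}_t=\sigma_j^2u^{(j)}_{xx}\ \ (x_{j-1}<x<x_j),\qquad u^{(j)}(x,0)=u^{(j)}_0(x),\qquad 1\le j\le n+1,$$ $$\beta_1u^{(1)}(x_0,t)+\beta_2u^{(1)}_x(x_0,t)=f_1(t),\qquad \beta_3u^{(n+1)}(x_{n+1},t)+\beta_4u_x^{(n+1)}(x_{n+1},t)=f_2(t),$$ $$u^{(j)}(x_j,t)=u^{(j+1)}(x_j,t),\qquad \sigma_j^2u_x^{(j)}(x_j,t)=\sigma_{j+1}^2u_x^{(j+1)}(x_j,t),\qquad 1\le j\le n.$$ A solution means a real classical solution: for $t>0$, $u^{(j)}$ and $u^{(j)}_x$ exist and are continuous on $[x_{j-1},x_j]\times(0,\infty)$ (with one-sided $x$-derivatives at the ends), $u^{(j)}_t$ and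 $u^{(j)}_{xx}$ exist and are continuous on $(x_{j-1},x_j)\times(0,\infty)$; the datum $u_0^{(j)}\in L^1(x_{j-1},x_j)$ is attained in $L^1(x_{j-1},x_j)$ as $t\to0^+$; and the boundary values $u^{(j)}(x_{j-1},\cdot),u^{(j)}(x_j,\cdot),u^{(j)}_x(x_{j-1},\cdot),u^{(j)}_x(x_j,\cdot)$ are integrable on $(0,T)$ for every $T>0$. (No compatibility of the data at the corners is required.) Put $\hat u^{(j)}(k,t)=\int_{x_{j-1}}^{x_j}e^{-ikx}u^{(j)}(x,t)\,dx$, $\hat u^{(j)}_0(k)=\int_{x_{j-1}}^{x_j}e^{-ikx}u^{(j)}_0(x)\,dx$, $\tilde f_m(\omega,T)=\int_0^Te^{\omega s}f_m(s)\,ds$, and let $g^{(j)}_0,g^{(j)}_1,h^{(j)}_0,h^{(j)}_1$ at $(\omega,T)$ be $\int_0^Te^{\omega s}(\cdot)\,ds$ of, respectively, $u^{(j)}(x_{j-1},s)$, $u_x^{(j)}(x_{j-1},s)$, $u^{(j)}(x_j,s)$, $u^{(j)}_x(x_j,s)$. For $R>0$ let $D_R^\pm=\{\nu\in\mathbb C^\pm:\operatorname{Re}\nu^2<0,\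 |\nu|>R\}$, with boundaries positively oriented ($D_R^\pm$ on the left). For $$X=\big(g_0^{(1)},\dots,g_0^{(n+1)},h_0^{(n+1)},g_1^{(1)},\dots,g_1^{(n+1)},h_1^{(n+1)}\big)^\top$$ let $\mathcal A^{(p)}(\nu)$ be the $(2n+4)\times(2n+4)$ matrix for which $\mathcal A^{(p)}(\nu)X$ has, in this order, the entries $$\beta_1g^{(1)}_0+\beta_2g_1^{(1)};$$ $$e^{-i\nu x_j/\sigma_j}\big(\sigma_{j+1}^2g_1^{(j+1)}+i\sigma_j\nu g_0^{(j+1)}\big)-e^{-i\nu x_{j-1}/\sigma_j}\big(\sigma_j^2g_1^{(j)}+i\sigma_j\nu g_0^{(j)}\big),\quad 1\le j\le n+1;$$ $$e^{i\nu x_j/\sigma_j}\big(\sigma_{j+1}^2g_1^{(j+1)}-i\sigma_j\nu g_0^{(j+1)}\big)-e^{i\nu x_{j-1}/\sigma_j}\big(\sigma_j^2g_1^{(j)}-i\sigma_j\nu g_0^{(j)}\big),\quad 1\le j\le n+1;$$ $$\beta_3h_0^{(n+1)}+\beta_4h_1^{(n+1)},$$ where for $j=n+1$ one reads $g_\ell^{(n+2)}:=h_\ell^{(n+1)}$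 and $\sigma_{n+2}:=\sigma_{n+1}$. Let $$Y(\nu,T)=\Big(\tilde f_1(\nu^2,T),\big(-\hat u^{(j)}_0(\tfrac{\nu}{\sigma_j})\big)_{j=1}^{n+1},\big(-\hat u^{(j)}_0(\tfrac{-\nu}{\sigma_j})\big)_{j=1}^{n+1},\tilde f_2(\nu^2,T)\Big)^\top,$$ $$\mathcal Y(\nu,T)=e^{\nu^2T}\Big(0,\big(\hat u^{(j)}(\tfrac{\nu}{\sigma_j},T)\big)_{j=1}^{n+1},\big(\hat u^{(j)}(\tfrac{-\nu}{\sigma_j},T)\big)_{j=1}^{n+1},0\Big)^\top .$$ Then there is $R_0>0$, depending only on $n$, the $x_j$, the $\sigma_j$ and the $\beta_m$, such that for every $R\ge R_0$ the matrix $\mathcal A^{(p)}(\nu)$ is nonsingular for all $\nu\in\overline{D_R^+}\cup\overline{D_R^-}$ and, for all data $u_0,f_1,f_2$, every solution $u$ and every $T>0$: 1. the vector $X$ of the transforms of $u$ satisfies $\mathcal A^{(p)}(\nu)X=\mathcal Y(\nu,T)+Y(\nu,T)$ for all $\nu\in\mathbb C$; 2. for $1\le j\le n+1$, $x_{j-1}<x<x_j$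 and $0<t\le T$, $$u^{(j)}(x,t)=\frac1{2\pi}\int_{-\infty}^\infty e^{ikx-\sigma_j^2k^2t}\hat u_0^{(j)}(k)\,dk-\frac1{2\pi}\int_{\partial D_R^-}e^{\frac{i\nu(x-x_j)}{\sigma_j}-\nu^2t}\Big(\tfrac{\sigma_{j+1}^2}{\sigma_j}g_1^{(j+1)}+i\nu g_0^{(j+1)}\Big)d\nu-\frac1{2\pi}\int_{\partial D_R^+}e^{\frac{i\nu(x-x_{j-1})}{\sigma_j}-\nu^2t}\Big(\sigma_jg_1^{(j)}+i\nu g_0^{(j)}\Big)d\nu \qquad(*)$$ (with the same reading for $j=n+1$), all integrals converging absolutely; 3. $(*)$ also holds, with absolutely convergent integrals, if in its right-hand side the unknowns are replaced by the entries of the solution of the linear system $\mathcal A^{(p)}(\nu)X^{(p)}=Y(\nu,T)$, which involves only the data; 4. if instead the unknowns are replaced by the entries of the solution of $\mathcal A^{(p)}(\nu)X^{(p)}=\mathcal Y(\nu,T)$, then for all $j$, $x_{j-1}<x<x_j$ and $0<t\le T$ each of the two contour integrals in $(*)$ converges absolutely and equals $0$. -/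

import Mathlib

open Set Filter Topology MeasureTheory

noncomputable section

namespace Multilayer

/-- A wall made of `n + 1` homogeneous layers, separated by `n` interfaces.
Layers are numbered from `0`: layer `j : Fin (n + 1)` occupies
`[x j.castSucc, x j.succ]` and has conductivity `(σ j) ^ 2`, with `σ j > 0`.
The numbers `β₁, β₂` (resp. `β₃, β₄`) are the coefficients of the boundary condition at the left
(resp. right) end of the wall. -/
structure Wall (n : ℕ) where
  x : Fin (n + 2) → ℝ
  x_strictMono : StrictMono x
  σ : Fin (n + 1) → ℝ
  σ_pos : ∀ j, 0 < σ j
  β₁ : ℝ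
  β₂ : ℝ
  β₃ : ℝ
  β₄ : ℝ
  left_ne : β₁ ≠ 0 ∨ β₂ ≠ 0
  right_ne : β₃ ≠ 0 ∨ β₄ ≠ 0

variable {n : ℕ}

namespace Wall

/-- Left end point of layer `j`. -/
def left (W : Wall n) (j : Fin (n + 1)) : ℝ := W.x j.castSucc

/-- Right end point of layer `j`. -/
def right (W : Wall n) (j : Fin (n + 1)) : ℝ := W.x j.succ

/-- The space derivative `u_x` of the temperature in layer `j`, one-sided at the two ends of the
layer. -/
def dx (W : Wall n) (u : Fin (n + 1) → ℝ → ℝ → ℝ) (j : Fin (n + 1)) (y t : ℝ) : ℝ :=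
  derivWithin (fun z => u j z t) (Icc (W.left j) (W.right j)) y

/-- `u j y t` (layer `j`, position `y`, time `t`) is a classical solution for `t > 0` of the heat
equation in every layer, with perfect contact at the interfaces, initial datum `u₀` and
boundary data `f₁, f₂`.  No compatibility of the data at the corners is required: the initial datum
is attained in `L¹`, and the boundary values of `u` and `u_x` are only required to be integrable
near `t = 0`. -/
structure IsPerfectContactSolution (W : Wall n) (u₀ : Fin (n + 1) → ℝ → ℝ) (f₁ f₂ : ℝ → ℝ)
    (u : Fin (n + 1) → ℝ → ℝ → ℝ) : Prop where
  /-- `u` is continuous up to the ends of each layer. -/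
  continuousOn_u : ∀ j, ContinuousOn (fun p : ℝ × ℝ => u j p.1 p.2)
    (Icc (W.left j) (W.right j) ×ˢ Ioi 0)
  /-- `u` is differentiable in `x` up to the ends of each layer. -/
  differentiableOn_u : ∀ j, ∀ t > 0,
    DifferentiableOn ℝ (fun y => u j y t) (Icc (W.left j) (W.right j))
  /-- `u_x` is continuous up to the ends of each layer. -/
  continuousOn_dx : ∀ j, ContinuousOn (fun p : ℝ × ℝ => W.dx u j p.1 p.2)
    (Icc (W.left j) (W.right j) ×ˢ Ioi 0)
  /-- `u_t` exists inside each layer. -/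
  differentiableAt_time : ∀ j, ∀ y ∈ Ioo (W.left j) (W.right j), ∀ t > 0,
    DifferentiableAt ℝ (fun s => u j y s) t
  /-- `u_xx` exists inside each layer. -/
  differentiableAt_dx : ∀ j, ∀ y ∈ Ioo (W.left j) (W.right j), ∀ t > 0,
    DifferentiableAt ℝ (fun z => W.dx u j z t) y
  /-- `u_t` is continuous inside each layer (hence so is `u_xx`, by the equation). -/
  continuousOn_time : ∀ j, ContinuousOn (fun p : ℝ × ℝ => deriv (fun s => u j p.1 s) p.2)
    (Ioo (W.left j) (W.right j) ×ˢ Ioi 0)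
  /-- The heat equation `u_t = σ_j² u_xx`. -/
  heat : ∀ j, ∀ y ∈ Ioo (W.left j) (W.right j), ∀ t > 0,
    deriv (fun s => u j y s) t = W.σ j ^ 2 * deriv (fun z => W.dx u j z t) y
  /-- The initial datum is integrable. -/
  integrable_initial : ∀ j, IntervalIntegrable (u₀ j) volume (W.left j) (W.right j)
  /-- The initial condition. -/
  initial : ∀ j, Tendsto (fun t => ∫ y in (W.left j)..(W.right j), |u j y t - u₀ j y|)
    (𝓝[>] 0) (𝓝 0)
  integrable_left : ∀ j, ∀ T > 0,
    IntervalIntegrable (fun s => u j (W.left j) s) volume 0 T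
  integrable_right : ∀ j, ∀ T > 0,
    IntervalIntegrable (fun s => u j (W.right j) s) volume 0 T
  integrable_dx_left : ∀ j, ∀ T > 0,
    IntervalIntegrable (fun s => W.dx u j (W.left j) s) volume 0 T
  integrable_dx_right : ∀ j, ∀ T > 0,
    IntervalIntegrable (fun s => W.dx u j (W.right j) s) volume 0 T
  /-- The boundary condition at the left end of the wall. -/
  boundary_left : ∀ t > 0,
    W.β₁ * u 0 (W.left 0) t + W.β₂ * W.dx u 0 (W.left 0) t = f₁ t
  /-- The boundary condition at the right end of the wall. -/
  boundary_right : ∀ t > 0,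
    W.β₃ * u (Fin.last n) (W.right (Fin.last n)) t
      + W.β₄ * W.dx u (Fin.last n) (W.right (Fin.last n)) t = f₂ t
  /-- Continuity of the temperature across each interface. -/
  contact_u : ∀ i : Fin n, ∀ t > 0,
    u i.castSucc (W.right i.castSucc) t = u i.succ (W.left i.succ) t
  /-- Continuity of the heat flux across each interface. -/
  contact_flux : ∀ i : Fin n, ∀ t > 0,
    W.σ i.castSucc ^ 2 * W.dx u i.castSucc (W.right i.castSucc) t
      = W.σ i.succ ^ 2 * W.dx u i.succ (W.left i.succ) t

/-! ### Transforms -/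

/-- The Fourier transform over layer `j`: `∫ e^{-iky} v(y) dy`. -/
def hat (W : Wall n) (j : Fin (n + 1)) (v : ℝ → ℝ) (k : ℂ) : ℂ :=
  ∫ y in (W.left j)..(W.right j), Complex.exp (-Complex.I * k * y) * (v y : ℂ)

/-- The time transform `∫₀ᵀ e^{ωs} f(s) ds`. -/
def _root_.Multilayer.timeTransform (f : ℝ → ℝ) (ω : ℂ) (T : ℝ) : ℂ :=
  ∫ s in (0 : ℝ)..T, Complex.exp (ω * s) * (f s : ℂ)

/-- The sequence `σ_1, …, σ_{n+1}, σ_{n+1}` of length `n + 2`. -/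
def σext (W : Wall n) : Fin (n + 2) → ℝ :=
  Fin.snoc (α := fun _ => ℝ) W.σ (W.σ (Fin.last n))

/-! ### The linear system

Vectors of length `2n + 4` are indexed by `Fin (n + 2) ⊕ Fin (n + 2)`: upper half and lower half. -/

/-- The vector `(g₀⁽¹⁾, …, g₀⁽ⁿ⁺¹⁾, h₀⁽ⁿ⁺¹⁾, g₁⁽¹⁾, …, g₁⁽ⁿ⁺¹⁾, h₁⁽ⁿ⁺¹⁾)` of the time transforms,
at `(ν², T)`, of the boundary values of `u` and `u_x`. -/
def traceTransforms (W : Wall n) (u : Fin (n + 1) → ℝ → ℝ → ℝ) (T : ℝ) (ν : ℂ) :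
    Fin (n + 2) ⊕ Fin (n + 2) → ℂ :=
  Sum.elim
    (Fin.snoc (α := fun _ => ℂ)
      (fun j => timeTransform (fun s => u j (W.left j) s) (ν ^ 2) T)
      (timeTransform (fun s => u (Fin.last n) (W.right (Fin.last n)) s) (ν ^ 2) T))
    (Fin.snoc (α := fun _ => ℂ)
      (fun j => timeTransform (fun s => W.dx u j (W.left j) s) (ν ^ 2) T)
      (timeTransform (fun s => W.dx u (Fin.last n) (W.right (Fin.last n)) s) (ν ^ 2) T))

/-- The right-hand side built from the data, with entries
`f̃₁(ν², T)`, `-û₀⁽ʲ⁾(ν/σ_j)`, `-û₀⁽ʲ⁾(-ν/σ_j)`, `f̃₂(ν², T)`. -/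
def dataVector (W : Wall n) (u₀ : Fin (n + 1) → ℝ → ℝ) (f₁ f₂ : ℝ → ℝ) (T : ℝ) (ν : ℂ) :
    Fin (n + 2) ⊕ Fin (n + 2) → ℂ :=
  Sum.elim
    (Fin.cons (α := fun _ => ℂ) (timeTransform f₁ (ν ^ 2) T)
      (fun j => -W.hat j (u₀ j) (ν / W.σ j)))
    (Fin.snoc (α := fun _ => ℂ) (fun j => -W.hat j (u₀ j) (-ν / W.σ j))
      (timeTransform f₂ (ν ^ 2) T))

/-- The right-hand side built from the unknown temperature at the final time `T`, with entries
`0`, `e^{ν²T} û⁽ʲ⁾(ν/σ_j, T)`, `e^{ν²T} û⁽ʲ⁾(-ν/σ_j, T)`, `0`. -/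
def finalVector (W : Wall n) (u : Fin (n + 1) → ℝ → ℝ → ℝ) (T : ℝ) (ν : ℂ) :
    Fin (n + 2) ⊕ Fin (n + 2) → ℂ :=
  Sum.elim
    (Fin.cons (α := fun _ => ℂ) 0
      (fun j => Complex.exp (ν ^ 2 * T) * W.hat j (fun y => u j y T) (ν / W.σ j)))
    (Fin.snoc (α := fun _ => ℂ)
      (fun j => Complex.exp (ν ^ 2 * T) * W.hat j (fun y => u j y T) (-ν / W.σ j)) 0)

/-- `e^{iνp/σ_j}`. -/
def phase (W : Wall n) (j : Fin (n + 1)) (p : ℝ) (ν : ℂ) : ℂ :=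
  Complex.exp (Complex.I * ν * p / W.σ j)

def A₁₁ (W : Wall n) (ν : ℂ) : Matrix (Fin (n + 2)) (Fin (n + 2)) ℂ :=
  Matrix.of (Fin.cons (α := fun _ => Fin (n + 2) → ℂ) (Pi.single 0 (W.β₁ : ℂ)) fun j =>
    Pi.single j.castSucc (-(Complex.I * W.σ j * ν * W.phase j (W.left j) (-ν)))
      + Pi.single j.succ (Complex.I * W.σ j * ν * W.phase j (W.right j) (-ν)))

def A₁₂ (W : Wall n) (ν : ℂ) : Matrix (Fin (n + 2)) (Fin (n + 2)) ℂ :=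
  Matrix.of (Fin.cons (α := fun _ => Fin (n + 2) → ℂ) (Pi.single 0 (W.β₂ : ℂ)) fun j =>
    Pi.single j.castSucc (-((W.σ j : ℂ) ^ 2 * W.phase j (W.left j) (-ν)))
      + Pi.single j.succ ((W.σext j.succ : ℂ) ^ 2 * W.phase j (W.right j) (-ν)))

def A₂₁ (W : Wall n) (ν : ℂ) : Matrix (Fin (n + 2)) (Fin (n + 2)) ℂ :=
  Matrix.of (Fin.snoc (α := fun _ => Fin (n + 2) → ℂ) (fun j =>
    Pi.single j.castSucc (Complex.I * W.σ j * ν * W.phase j (W.left j) ν)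
      + Pi.single j.succ (-(Complex.I * W.σ j * ν * W.phase j (W.right j) ν)))
    (Pi.single (Fin.last (n + 1)) (W.β₃ : ℂ)))

def A₂₂ (W : Wall n) (ν : ℂ) : Matrix (Fin (n + 2)) (Fin (n + 2)) ℂ :=
  Matrix.of (Fin.snoc (α := fun _ => Fin (n + 2) → ℂ) (fun j =>
    Pi.single j.castSucc (-((W.σ j : ℂ) ^ 2 * W.phase j (W.left j) ν))
      + Pi.single j.succ ((W.σext j.succ : ℂ) ^ 2 * W.phase j (W.right j) ν))
    (Pi.single (Fin.last (n + 1)) (W.β₄ : ℂ)))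

/-- The `(2n + 4) × (2n + 4)` matrix of the linear system, made of four `(n + 2) × (n + 2)`
blocks. -/
def A (W : Wall n) (ν : ℂ) : Matrix (Fin (n + 2) ⊕ Fin (n + 2)) (Fin (n + 2) ⊕ Fin (n + 2)) ℂ :=
  Matrix.fromBlocks (W.A₁₁ ν) (W.A₁₂ ν) (W.A₂₁ ν) (W.A₂₂ ν)

end Wall

/-! ### Contours -/

/-- The region `{ν ∈ ℂ⁺ : Re ν² < 0, |ν| > R}`. -/
def DPlus (R : ℝ) : Set ℂ := {ν | 0 < ν.im ∧ (ν ^ 2).re < 0 ∧ R < ‖ν‖}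

/-- The region `{ν ∈ ℂ⁻ : Re ν² < 0, |ν| > R}`. -/
def DMinus (R : ℝ) : Set ℂ := {ν | ν.im < 0 ∧ (ν ^ 2).re < 0 ∧ R < ‖ν‖}

/-- `F` is absolutely integrable along the boundary of the truncated sector
`{r e^{iθ} : r > R, a < θ < b}`. -/
def SectorBoundaryIntegrable (a b R : ℝ) (F : ℂ → ℂ) : Prop :=
  IntegrableOn (fun r : ℝ => F (r * Complex.exp (a * Complex.I))) (Ioi R) ∧
  IntegrableOn (fun r : ℝ => F (r * Complex.exp (b * Complex.I))) (Ioi R) ∧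
  IntervalIntegrable (fun θ : ℝ => F (R * Complex.exp (θ * Complex.I))) volume a b

/-- The integral of `F` along the boundary of `{r e^{iθ} : r > R, a < θ < b}`, oriented so that the
sector lies on the left: in along the ray `θ = b`, along the arc `|ν| = R` from `θ = b` to `θ = a`,
and out along the ray `θ = a`. -/
def sectorBoundaryIntegral (a b R : ℝ) (F : ℂ → ℂ) : ℂ :=
  -(∫ r in Ioi R, F (r * Complex.exp (b * Complex.I)) * Complex.exp (b * Complex.I))
    + (∫ θ in b..a, F (R * Complex.exp (θ * Complex.I)) *
        (R * Complex.I * Complex.exp (θ * Complex.I)))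
    + ∫ r in Ioi R, F (r * Complex.exp (a * Complex.I)) * Complex.exp (a * Complex.I)

/-- Absolute integrability along `∂D_R⁺`. -/
def PlusIntegrable (R : ℝ) (F : ℂ → ℂ) : Prop :=
  SectorBoundaryIntegrable (Real.pi / 4) (3 * Real.pi / 4) R F

/-- Absolute integrability along `∂D_R⁻`. -/
def MinusIntegrable (R : ℝ) (F : ℂ → ℂ) : Prop :=
  SectorBoundaryIntegrable (-(3 * Real.pi / 4)) (-(Real.pi / 4)) R F

/-- The integral along the positively oriented boundary `∂D_R⁺`. -/
def plusIntegral (R : ℝ) (F : ℂ → ℂ) : ℂ :=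
  sectorBoundaryIntegral (Real.pi / 4) (3 * Real.pi / 4) R F

/-- The integral along the positively oriented boundary `∂D_R⁻`. -/
def minusIntegral (R : ℝ) (F : ℂ → ℂ) : ℂ :=
  sectorBoundaryIntegral (-(3 * Real.pi / 4)) (-(Real.pi / 4)) R F

/-! ### The solution formula -/

namespace Wall

/-- The integrand `e^{iky - (σ_j k)² t} û₀⁽ʲ⁾(k)`. -/
def initialIntegrand (W : Wall n) (u₀ : Fin (n + 1) → ℝ → ℝ) (j : Fin (n + 1)) (y t k : ℝ) : ℂ :=
  Complex.exp (Complex.I * k * y - ((W.σ j : ℂ) * k) ^ 2 * t) * W.hat j (u₀ j) k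

/-- The integrand over `∂D_R⁻`.  With `X` the vector of unknowns the bracket is
`(σ_{j+1}² / σ_j) g₁⁽ʲ⁺¹⁾ + i ν g₀⁽ʲ⁺¹⁾`, and `σ_{n+1} h₁⁽ⁿ⁺¹⁾ + i ν h₀⁽ⁿ⁺¹⁾` in the last layer. -/
def minusIntegrand (W : Wall n) (X : ℂ → Fin (n + 2) ⊕ Fin (n + 2) → ℂ) (j : Fin (n + 1))
    (y t : ℝ) (ν : ℂ) : ℂ :=
  Complex.exp (Complex.I * ν * (y - W.right j) / W.σ j - ν ^ 2 * t) *
    ((W.σext j.succ : ℂ) ^ 2 / W.σ j * X ν (Sum.inr j.succ)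
      + Complex.I * ν * X ν (Sum.inl j.succ))

/-- The integrand over `∂D_R⁺`.  With `X` the vector of unknowns the bracket is
`σ_j g₁⁽ʲ⁾ + i ν g₀⁽ʲ⁾`. -/
def plusIntegrand (W : Wall n) (X : ℂ → Fin (n + 2) ⊕ Fin (n + 2) → ℂ) (j : Fin (n + 1))
    (y t : ℝ) (ν : ℂ) : ℂ :=
  Complex.exp (Complex.I * ν * (y - W.left j) / W.σ j - ν ^ 2 * t) *
    ((W.σ j : ℂ) * X ν (Sum.inr j.castSucc) + Complex.I * ν * X ν (Sum.inl j.castSucc))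

/-- All integrals of the solution formula with unknowns `X` converge absolutely, and the formula
gives the temperature `u` in the interior of every layer and for all times `0 < t ≤ T`. -/
def Represents (W : Wall n) (R T : ℝ) (u₀ : Fin (n + 1) → ℝ → ℝ)
    (X : ℂ → Fin (n + 2) ⊕ Fin (n + 2) → ℂ) (u : Fin (n + 1) → ℝ → ℝ → ℝ) : Prop :=
  ∀ j, ∀ y ∈ Ioo (W.left j) (W.right j), ∀ t ∈ Ioc 0 T,
    Integrable (W.initialIntegrand u₀ j y t) ∧
    MinusIntegrable R (W.minusIntegrand X j y t) ∧
    PlusIntegrable R (W.plusIntegrand X j y t) ∧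
    (u j y t : ℂ) =
      1 / (2 * Real.pi) * (∫ k : ℝ, W.initialIntegrand u₀ j y t k)
        - 1 / (2 * Real.pi) * minusIntegral R (W.minusIntegrand X j y t)
        - 1 / (2 * Real.pi) * plusIntegral R (W.plusIntegrand X j y t)

/-- Substituted for the unknowns in the solution formula, `Z` contributes nothing: its two contour
integrals converge absolutely and vanish, in every layer and for all times `0 < t ≤ T`. -/
def NoContribution (W : Wall n) (R T : ℝ) (Z : ℂ → Fin (n + 2) ⊕ Fin (n + 2) → ℂ) : Prop :=
  ∀ j, ∀ y ∈ Ioo (W.left j) (W.right j), ∀ t ∈ Ioc 0 T,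
    MinusIntegrable R (W.minusIntegrand Z j y t) ∧
    PlusIntegrable R (W.plusIntegrand Z j y t) ∧
    minusIntegral R (W.minusIntegrand Z j y t) = 0 ∧
    plusIntegral R (W.plusIntegrand Z j y t) = 0

end Wall

end Multilayer

end

/-!
The layered heat problem is solved by the unified transform. In each layer the Fourier transform of
the temperature satisfies a *global relation* (`global_relation`): integrating the divergence form
of the heat equation against `e^{-iky + σ²k²s}` over `[left, right] × [0, T]` leaves only the
transforms of the initial and final temperatures and the time transforms of the four boundary
values. Written at `k = ± ν/σ_j`, where all layers share the frequency `ν²`, these relations and the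
two boundary conditions are exactly the rows of `A(ν)` (`mulVec_traceTransforms`).

*Invertibility and the vanishing contribution.* In terms of `iν g₀` and the flux `σ² g₁`, and after
multiplying each row by its dominant phase, the unknowns at different nodes are coupled only through
`e^{iν(x_j - x_{j-1})/σ_j}`, which is exponentially small in the closed sector `D_R⁺`. At a single
node the system is inverted with bounds uniform in `ν` (`exists_bound_nodes`); the coupling is then
absorbed for large `|ν|` (`exists_bound_solution`). This gives both `det A ≠ 0` and a bound by
`|e^{ν²T}|` for the solution driven by the final temperature. By Cramer's rule that solution is
holomorphic, the factor `e^{-ν²t}` is compensated as `t ≤ T`, and `e^{iν(x - x_{j-1})/σ_j}` decays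
exponentially, so Cauchy's theorem in the sector makes the contour integrals vanish
(`exists_contour_vanish`). The half turn `ν ↦ -ν` permutes the rows of `A(ν)`, hence the solution is
even in `ν` and everything in `D_R⁻` reduces to `D_R⁺`.

*The representation.* The global relation at time `t` is multiplied by `e^{ikx - σ²k²(t+δ)}` and
integrated over the real line, where all integrals converge absolutely thanks to `δ > 0`. As `δ → 0`
the left-hand side tends to `2π u(x, t)` (`tendsto_regularized`), while the boundary terms, entire in
`ν`, are first moved to `∂D_R^±` (`integral_real_eq_plusIntegral`), where they converge absolutely
without regularization. The traces after time `t` can be added freely, since their contribution is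
holomorphic and decays in the sector (`contourTerm_future`). Finally the formula for the solution
driven by the data follows by subtracting the vanishing contribution.
-/

noncomputable section

namespace Multilayer

variable {n : ℕ}

/-! ### Contour integrals along sectors -/

/-- The profile dominating every contour integrand: exponential decay up to a linear factor. -/
def decay (C c r : ℝ) : ℝ := C * (1 + r) * Real.exp (-(c * r))

lemma continuous_decay (C c : ℝ) : Continuous (decay C c) := by
  unfold decay; fun_prop

lemma tendsto_id_mul_decay (C : ℝ) {c : ℝ} (hc : 0 < c) :
    Tendsto (fun r => r * decay C c r) atTop (𝓝 0) := by
  have h1 := Real.tendsto_pow_mul_exp_neg_atTop_nhds_zero 1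
  have h2 := Real.tendsto_pow_mul_exp_neg_atTop_nhds_zero 2
  have hr : Tendsto (fun r : ℝ => c * r) atTop atTop := tendsto_id.const_mul_atTop hc
  have h := ((h1.comp hr).const_mul (C / c)).add ((h2.comp hr).const_mul (C / c ^ 2))
  rw [mul_zero, mul_zero, add_zero] at h
  refine h.congr fun r => ?_
  simp only [Function.comp, decay]
  field_simp

lemma integrableOn_decay (C : ℝ) {c : ℝ} (hc : 0 < c) (R : ℝ) :
    IntegrableOn (decay C c) (Ioi R) := by
  refine integrable_of_isBigO_exp_neg (b := c / 2) (by positivity)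
    (continuous_decay C c).continuousOn ?_
  have h := tendsto_id_mul_decay C (half_pos hc)
  have h' : Tendsto (fun r => decay C (c / 2) r) atTop (𝓝 0) := by
    have := tendsto_inv_atTop_zero.mul h
    rw [zero_mul] at this
    refine this.congr' ?_
    filter_upwards [eventually_gt_atTop 0] with r hr
    field_simp
  have e : decay C c = fun r => decay C (c / 2) r * Real.exp (-(c / 2) * r) := by
    ext r
    simp only [decay]
    rw [mul_assoc (C * (1 + r)), ← Real.exp_add]
    ring_nf
  rw [e]
  simpa using (h'.isBigO_one ℝ).mul
    (Asymptotics.isBigO_refl (fun r : ℝ => Real.exp (-(c / 2) * r)) atTop)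

lemma norm_mul_exp_mul_I {r : ℝ} (hr : 0 ≤ r) (θ : ℝ) :
    ‖(r : ℂ) * Complex.exp (θ * Complex.I)‖ = r := by
  rw [norm_mul, Complex.norm_exp_ofReal_mul_I, mul_one, Complex.norm_real, Real.norm_of_nonneg hr]

/-- Cauchy's theorem on an annular sector: in logarithmic coordinates it is a rectangle. -/
lemma integral_boundary_annularSector_eq_zero {F : ℂ → ℂ} {a b R R' : ℝ} (hab : a ≤ b)
    (hR : 0 < R) (hRR : R ≤ R')
    (hd : ∀ r ∈ Icc R R', ∀ θ ∈ Icc a b, DifferentiableAt ℂ F (r * Complex.exp (θ * Complex.I))) :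
    (∫ r in R..R', F (r * Complex.exp (a * Complex.I)) * Complex.exp (a * Complex.I))
      - (∫ r in R..R', F (r * Complex.exp (b * Complex.I)) * Complex.exp (b * Complex.I))
      + (∫ θ in a..b, F (R' * Complex.exp (θ * Complex.I)) *
          (R' * Complex.I * Complex.exp (θ * Complex.I)))
      - (∫ θ in a..b, F (R * Complex.exp (θ * Complex.I)) *
          (R * Complex.I * Complex.exp (θ * Complex.I))) = 0 := by
  have hR' : 0 < R' := hR.trans_le hRR
  have hlog : Real.log R ≤ Real.log R' := Real.log_le_log hR hRR
  have key := Complex.integral_boundary_rect_eq_zero_of_differentiableOn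
    (fun w => F (Complex.exp w) * Complex.exp w) (Real.log R + a * Complex.I)
    (Real.log R' + b * Complex.I) ?_
  · have ray : ∀ θ ∈ Icc a b, (∫ x in Real.log R..Real.log R',
        F (Complex.exp (x + θ * Complex.I)) * Complex.exp (x + θ * Complex.I))
        = ∫ r in R..R', F (r * Complex.exp (θ * Complex.I)) * Complex.exp (θ * Complex.I) := by
      intro θ hθ
      have := intervalIntegral.integral_deriv_smul_comp' (f := Real.exp) (f' := Real.exp)
        (g := fun r : ℝ => F (r * Complex.exp (θ * Complex.I)) * Complex.exp (θ * Complex.I))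
        (a := Real.log R) (b := Real.log R') (fun x _ => Real.hasDerivAt_exp x)
        Real.continuous_exp.continuousOn ?_
      · rw [Real.exp_log hR, Real.exp_log hR'] at this
        rw [← this]
        refine intervalIntegral.integral_congr fun x _ => ?_
        simp only [Function.comp, Complex.exp_add, Complex.ofReal_exp, Complex.real_smul]
        ring
      · rintro r ⟨x, hx, rfl⟩
        rw [uIcc_of_le hlog] at hx
        have h1 : Real.exp x ∈ Icc R R' :=
          ⟨by rw [← Real.exp_log hR]; exact Real.exp_le_exp.2 hx.1,
            by rw [← Real.exp_log hR']; exact Real.exp_le_exp.2 hx.2⟩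
        have h2 := (hd _ h1 θ hθ).continuousAt
        refine ContinuousAt.continuousWithinAt (ContinuousAt.mul ?_ continuousAt_const)
        exact ContinuousAt.comp (g := F)
          (f := fun r : ℝ => (r : ℂ) * Complex.exp (θ * Complex.I)) h2 (by fun_prop)
    have arc : ∀ ρ : ℝ, 0 < ρ → Complex.I * (∫ θ in a..b,
        F (Complex.exp (Real.log ρ + θ * Complex.I)) * Complex.exp (Real.log ρ + θ * Complex.I))
        = ∫ θ in a..b, F (ρ * Complex.exp (θ * Complex.I)) *
          (ρ * Complex.I * Complex.exp (θ * Complex.I)) := by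
      intro ρ hρ
      rw [← intervalIntegral.integral_const_mul]
      refine intervalIntegral.integral_congr fun x _ => ?_
      simp only [Complex.exp_add]
      rw [← Complex.ofReal_exp, Real.exp_log hρ]
      ring
    simp only [Complex.add_re, Complex.add_im, Complex.ofReal_re, Complex.ofReal_im,
      Complex.mul_re, Complex.mul_im, Complex.I_re, Complex.I_im, mul_zero, mul_one, zero_add,
      add_zero, smul_eq_mul, sub_self] at key
    rw [ray a ⟨le_rfl, hab⟩, ray b ⟨hab, le_rfl⟩, arc R' hR', arc R hR] at key
    exact key
  · intro w hw
    simp only [Complex.add_re, Complex.add_im, Complex.ofReal_re, Complex.ofReal_im,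
      Complex.mul_re, Complex.mul_im, Complex.I_re, Complex.I_im, mul_zero, mul_one, zero_add,
      add_zero, sub_self, uIcc_of_le hlog, uIcc_of_le hab,
      Complex.mem_reProdIm] at hw
    have h1 : Real.exp w.re ∈ Icc R R' :=
      ⟨by rw [← Real.exp_log hR]; exact Real.exp_le_exp.2 hw.1.1,
        by rw [← Real.exp_log hR']; exact Real.exp_le_exp.2 hw.1.2⟩
    have h2 := hd _ h1 w.im hw.2
    rw [Complex.ofReal_exp, ← Complex.exp_add, Complex.re_add_im] at h2
    exact ((h2.comp w Complex.differentiableAt_exp).mul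
      Complex.differentiableAt_exp).differentiableWithinAt

lemma continuousOn_ray {F : ℂ → ℂ} {R θ : ℝ}
    (hd : ∀ r ≥ R, ContinuousAt F (r * Complex.exp (θ * Complex.I))) :
    ContinuousOn (fun r : ℝ => F (r * Complex.exp (θ * Complex.I))) (Ici R) := fun r hr =>
  (ContinuousAt.comp (g := F) (f := fun r : ℝ => (r : ℂ) * Complex.exp (θ * Complex.I))
    (hd r hr) (by fun_prop)).continuousWithinAt

lemma integrableOn_ray {F : ℂ → ℂ} {R C c θ : ℝ} (hc : 0 < c)
    (hd : ∀ r ≥ R, ContinuousAt F (r * Complex.exp (θ * Complex.I)))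
    (hb : ∀ r ≥ R, ‖F (r * Complex.exp (θ * Complex.I))‖ ≤ decay C c r) :
    IntegrableOn (fun r : ℝ => F (r * Complex.exp (θ * Complex.I))) (Ioi R) := by
  refine Integrable.mono' (integrableOn_decay C hc R)
    (((continuousOn_ray hd).mono Ioi_subset_Ici_self).aestronglyMeasurable measurableSet_Ioi) ?_
  filter_upwards [ae_restrict_mem measurableSet_Ioi] with r hr using hb r (le_of_lt hr)

lemma continuousOn_arc {F : ℂ → ℂ} {R a b : ℝ}
    (hd : ∀ θ ∈ Icc a b, ContinuousAt F (R * Complex.exp (θ * Complex.I))) :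
    ContinuousOn (fun θ : ℝ => F (R * Complex.exp (θ * Complex.I))) (Icc a b) := fun θ hθ =>
  (ContinuousAt.comp (g := F) (f := fun θ : ℝ => (R : ℂ) * Complex.exp (θ * Complex.I))
    (hd θ hθ) (by fun_prop)).continuousWithinAt

lemma sectorBoundaryIntegrable_of_decay {F : ℂ → ℂ} {a b R C c : ℝ} (hab : a ≤ b) (hc : 0 < c)
    (hd : ∀ r ≥ R, ∀ θ ∈ Icc a b, ContinuousAt F (r * Complex.exp (θ * Complex.I)))
    (hb : ∀ r ≥ R, ∀ θ ∈ Icc a b, ‖F (r * Complex.exp (θ * Complex.I))‖ ≤ decay C c r) :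
    SectorBoundaryIntegrable a b R F := by
  have ha' : a ∈ Icc a b := ⟨le_rfl, hab⟩
  have hb' : b ∈ Icc a b := ⟨hab, le_rfl⟩
  refine ⟨integrableOn_ray hc (fun r hr => hd r hr a ha') (fun r hr => hb r hr a ha'),
    integrableOn_ray hc (fun r hr => hd r hr b hb') (fun r hr => hb r hr b hb'),
    ContinuousOn.intervalIntegrable ?_⟩
  rw [uIcc_of_le hab]
  exact continuousOn_arc (hd R le_rfl)

/-- Cauchy's theorem on an unbounded truncated sector, for exponentially decaying functions. -/
lemma sectorBoundaryIntegral_eq_zero {F : ℂ → ℂ} {a b R C c : ℝ} (hab : a ≤ b) (hR : 0 < R)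
    (hc : 0 < c)
    (hd : ∀ r ≥ R, ∀ θ ∈ Icc a b, DifferentiableAt ℂ F (r * Complex.exp (θ * Complex.I)))
    (hb : ∀ r ≥ R, ∀ θ ∈ Icc a b, ‖F (r * Complex.exp (θ * Complex.I))‖ ≤ decay C c r) :
    sectorBoundaryIntegral a b R F = 0 := by
  have hi := sectorBoundaryIntegrable_of_decay hab hc
    (fun r hr θ hθ => (hd r hr θ hθ).continuousAt) hb
  have ray : ∀ θ : ℝ, IntegrableOn (fun r : ℝ => F (r * Complex.exp (θ * Complex.I))) (Ioi R) →
      Tendsto (fun R' => ∫ r in R..R', F (r * Complex.exp (θ * Complex.I)) *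
        Complex.exp (θ * Complex.I)) atTop
        (𝓝 (∫ r in Ioi R, F (r * Complex.exp (θ * Complex.I)) * Complex.exp (θ * Complex.I))) :=
    fun θ h => intervalIntegral_tendsto_integral_Ioi R (h.mul_const _) tendsto_id
  have arc : Tendsto (fun R' : ℝ => ∫ θ in a..b, F (R' * Complex.exp (θ * Complex.I)) *
      (R' * Complex.I * Complex.exp (θ * Complex.I))) atTop (𝓝 0) := by
    have h := (tendsto_id_mul_decay C hc).mul_const (|b - a|)
    rw [zero_mul] at h
    refine squeeze_zero_norm' ?_ h
    filter_upwards [eventually_ge_atTop R] with R' hR'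
    refine intervalIntegral.norm_integral_le_of_norm_le_const fun θ hθ => ?_
    rw [uIoc_of_le hab] at hθ
    rw [norm_mul, norm_mul, norm_mul, Complex.norm_I, Complex.norm_exp_ofReal_mul_I,
      Complex.norm_real, Real.norm_of_nonneg (hR.le.trans hR'), mul_one, mul_one, mul_comm]
    exact mul_le_mul_of_nonneg_left (hb R' hR' θ ⟨hθ.1.le, hθ.2⟩) (hR.le.trans hR')
  have lim := (((ray a hi.1).sub (ray b hi.2.1)).add arc).sub
    (tendsto_const_nhds (x := ∫ θ in a..b, F (R * Complex.exp (θ * Complex.I)) *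
          (R * Complex.I * Complex.exp (θ * Complex.I))))
  have hz := tendsto_nhds_unique (lim.congr' (f₂ := fun _ => (0 : ℂ)) ?_) tendsto_const_nhds
  · rw [sectorBoundaryIntegral, intervalIntegral.integral_symm a b]
    linear_combination hz
  · filter_upwards [eventually_ge_atTop R] with R' hR'
    exact integral_boundary_annularSector_eq_zero hab hR hR' fun r hr θ hθ => hd r hr.1 θ hθ

/-- Moving the real line into the upper half plane: if `F` is entire and decays exponentially
between the real line and the boundary rays of `D_R⁺`, then `∫_ℝ F = ∫_{∂D_R⁺} F`. -/
lemma integral_real_eq_plusIntegral {F : ℂ → ℂ} {R C c : ℝ} (hR : 0 < R) (hc : 0 < c)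
    (hF : Differentiable ℂ F)
    (hb : ∀ r ≥ R, ∀ θ ∈ Icc 0 (Real.pi / 4) ∪ Icc (3 * Real.pi / 4) Real.pi,
      ‖F (r * Complex.exp (θ * Complex.I))‖ ≤ decay C c r) :
    Integrable (fun k : ℝ => F k) ∧ ∫ k : ℝ, F k = plusIntegral R F := by
  have hπ := Real.pi_pos
  have hr : ∀ r ≥ R, ∀ θ ∈ Icc 0 (Real.pi / 4),
      ‖F (r * Complex.exp (θ * Complex.I))‖ ≤ decay C c r := fun r hr θ hθ => hb r hr θ (Or.inl hθ)
  have hl : ∀ r ≥ R, ∀ θ ∈ Icc (3 * Real.pi / 4) Real.pi,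
      ‖F (r * Complex.exp (θ * Complex.I))‖ ≤ decay C c r := fun r hr θ hθ => hb r hr θ (Or.inr hθ)
  have e1 := sectorBoundaryIntegral_eq_zero (by positivity) hR hc (fun r _ θ _ => hF _) hr
  have e2 := sectorBoundaryIntegral_eq_zero (by linarith) hR hc (fun r _ θ _ => hF _) hl
  have i1 := (sectorBoundaryIntegrable_of_decay (by positivity) hc
    (fun r _ θ _ => (hF _).continuousAt) hr).1
  have i2 := (sectorBoundaryIntegrable_of_decay (by linarith) hc
    (fun r _ θ _ => (hF _).continuousAt) hl).2.1
  have hcF : Continuous fun k : ℝ => F k := hF.continuous.comp Complex.continuous_ofReal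
  simp only [Complex.ofReal_zero, zero_mul, Complex.exp_zero, mul_one] at i1
  simp only [Complex.exp_pi_mul_I, mul_neg, mul_one] at i2
  have j1 : IntegrableOn (fun k : ℝ => F k) (Iic (-R)) := by
    rw [← neg_neg R] at i2
    simpa [integrableOn_Iic_iff_integrableOn_Iio] using i2.comp_neg_Iio
  have jc : IntegrableOn (fun k : ℝ => F k) (Iic R) := by
    rw [← Iic_union_Ioc_eq_Iic (show -R ≤ R by linarith)]
    exact j1.union (hcF.integrableOn_Ioc)
  have hint : Integrable (fun k : ℝ => F k) := by
    rw [← integrableOn_univ, ← Iic_union_Ioi (a := R)]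
    exact jc.union i1
  refine ⟨hint, ?_⟩
  have split : ∫ k : ℝ, F k = (∫ k in Ioi R, F (-k)) + (∫ k in (-R)..R, F k)
      + ∫ k in Ioi R, F k := by
    rw [← intervalIntegral.integral_Iic_add_Ioi jc i1,
      ← intervalIntegral.integral_Iic_sub_Iic j1 jc]
    have := integral_comp_neg_Ioi R (fun k : ℝ => F k)
    simp only [Complex.ofReal_neg] at this
    rw [this]
    ring
  -- the arcs are integrated through a primitive of `F`
  obtain ⟨P, hP⟩ := hF.isExactOn_univ
  have arc : ∀ a b : ℝ, ∫ θ in a..b, F (R * Complex.exp (θ * Complex.I)) *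
      (R * Complex.I * Complex.exp (θ * Complex.I))
      = P (R * Complex.exp (b * Complex.I)) - P (R * Complex.exp (a * Complex.I)) := by
    intro a b
    refine intervalIntegral.integral_eq_sub_of_hasDerivAt
      (f := fun θ : ℝ => P (R * Complex.exp (θ * Complex.I))) (fun θ _ => ?_) ?_
    · have h1 : HasDerivAt (fun θ : ℂ => (R : ℂ) * Complex.exp (θ * Complex.I))
          (R * Complex.I * Complex.exp (θ * Complex.I)) (θ : ℂ) := by
        have := (((hasDerivAt_id' (θ : ℂ)).mul_const Complex.I).cexp).const_mul (R : ℂ)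
        exact this.congr_deriv (by ring)
      exact ((hP _ (mem_univ _)).comp (θ : ℂ) h1).comp_ofReal
    · have := hF.continuous
      exact Continuous.intervalIntegrable (by fun_prop) _ _
  have seg : ∫ k in (-R)..R, F k = P R - P (-R) := by
    rw [intervalIntegral.integral_eq_sub_of_hasDerivAt (f := fun k : ℝ => P k)
      (fun k _ => (hP _ (mem_univ _)).comp_ofReal) (hcF.intervalIntegrable _ _)]
    simp
  have neg : ∫ r in Ioi R, F (r * -1) * -1 = - ∫ k in Ioi R, F (-k) := by
    rw [← integral_neg]
    simp
  rw [split, seg, plusIntegral, sectorBoundaryIntegral, arc]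
  simp only [sectorBoundaryIntegral, arc, Complex.exp_pi_mul_I, Complex.ofReal_zero, zero_mul,
    Complex.exp_zero, mul_one] at e1 e2
  simp only [mul_neg, mul_one, integral_neg] at e2
  linear_combination e1 + e2

/-! ### The contours `∂D_R^±` -/

/-- The closed truncated sector `{ν ∈ ℂ⁺ : Re ν² ≤ 0, |ν| ≥ R}`. -/
def upperSector (R : ℝ) : Set ℂ := {ν | ν.re ^ 2 ≤ ν.im ^ 2 ∧ 0 ≤ ν.im ∧ R ≤ ‖ν‖}

lemma sq_re_eq (ν : ℂ) : (ν ^ 2).re = ν.re ^ 2 - ν.im ^ 2 := by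
  rw [sq, Complex.mul_re]; ring

lemma closure_DPlus {R : ℝ} (hR : 0 < R) : closure (DPlus R) = upperSector R := by
  apply Subset.antisymm
  · refine closure_minimal ?_ ?_
    · rintro ν ⟨h1, h2, h3⟩
      rw [sq_re_eq] at h2
      exact ⟨by linarith, h1.le, h3.le⟩
    · have h1 : IsClosed {ν : ℂ | ν.re ^ 2 ≤ ν.im ^ 2} :=
        isClosed_le (by fun_prop) (by fun_prop)
      have h2 : IsClosed {ν : ℂ | 0 ≤ ν.im} := isClosed_le (by fun_prop) (by fun_prop)
      have h3 : IsClosed {ν : ℂ | R ≤ ‖ν‖} := isClosed_le (by fun_prop) (by fun_prop)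
      exact h1.inter (h2.inter h3)
  · -- an upward shift moves the closed sector into the open one
    rintro ν ⟨h1, h2, h3⟩
    have hn : R ^ 2 ≤ ν.re ^ 2 + ν.im ^ 2 := by
      have := Complex.sq_norm ν
      rw [Complex.normSq_apply] at this
      nlinarith [norm_nonneg ν]
    have hlim : Tendsto (fun s : ℝ => ν + s * Complex.I) (𝓝[>] 0) (𝓝 ν) := by
      have : Continuous fun s : ℝ => ν + s * Complex.I := by fun_prop
      simpa using (this.tendsto 0).mono_left nhdsWithin_le_nhds
    refine mem_closure_of_tendsto hlim ?_
    filter_upwards [self_mem_nhdsWithin] with s (hs : 0 < s)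
    refine ⟨by simp; linarith, ?_, ?_⟩
    · rw [sq_re_eq]; simp; nlinarith
    · refine lt_of_pow_lt_pow_left₀ 2 (norm_nonneg _) ?_
      rw [Complex.sq_norm, Complex.normSq_apply]
      simp; nlinarith

lemma mem_closure_DMinus {R : ℝ} (hR : 0 < R) {ν : ℂ} :
    ν ∈ closure (DMinus R) ↔ -ν ∈ upperSector R := by
  have h : DMinus R = (Homeomorph.neg ℂ) ⁻¹' DPlus R := by
    ext ν; simp [DMinus, DPlus]
  rw [h, ← (Homeomorph.neg ℂ).preimage_closure, closure_DPlus hR]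
  rfl

lemma upperSector_im {R : ℝ} {ν : ℂ} (h : ν ∈ upperSector R) : ‖ν‖ / 2 ≤ ν.im := by
  obtain ⟨h1, h2, -⟩ := h
  have := Complex.norm_le_abs_re_add_abs_im ν
  have h3 := sq_le_sq.1 h1
  rw [abs_of_nonneg h2] at this h3
  linarith

lemma polar_re_im (r θ : ℝ) : ((r : ℂ) * Complex.exp (θ * Complex.I)).re = r * Real.cos θ ∧
    ((r : ℂ) * Complex.exp (θ * Complex.I)).im = r * Real.sin θ := by
  simp [Complex.exp_ofReal_mul_I_re, Complex.exp_ofReal_mul_I_im]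

lemma polar_mem_upperSector {R r θ : ℝ} (hR : 0 < R) (hr : R ≤ r)
    (hθ : θ ∈ Icc (Real.pi / 4) (3 * Real.pi / 4)) :
    (r : ℂ) * Complex.exp (θ * Complex.I) ∈ upperSector R := by
  have hπ := Real.pi_pos
  have hr0 : 0 ≤ r := hR.le.trans hr
  have hs : 0 ≤ Real.sin θ := Real.sin_nonneg_of_nonneg_of_le_pi (by linarith [hθ.1])
    (by linarith [hθ.2])
  have hc := Real.cos_nonpos_of_pi_div_two_le_of_le (x := 2 * θ) (by linarith [hθ.1])
    (by linarith [hθ.2])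
  rw [Real.cos_two_mul'] at hc
  refine ⟨?_, ?_, ?_⟩
  · rw [(polar_re_im r θ).1, (polar_re_im r θ).2, mul_pow, mul_pow]
    exact mul_le_mul_of_nonneg_left (by linarith) (sq_nonneg r)
  · rw [(polar_re_im r θ).2]; positivity
  · rwa [norm_mul_exp_mul_I hr0]

lemma polar_side {r θ : ℝ} (hr : 0 ≤ r)
    (hθ : θ ∈ Icc 0 (Real.pi / 4) ∪ Icc (3 * Real.pi / 4) Real.pi) :
    ((r : ℂ) * Complex.exp (θ * Complex.I)).im ^ 2 ≤ ((r : ℂ) * Complex.exp (θ * Complex.I)).re ^ 2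
      ∧ 0 ≤ ((r : ℂ) * Complex.exp (θ * Complex.I)).im := by
  have hπ := Real.pi_pos
  have h : 0 ≤ Real.sin θ ∧ 0 ≤ Real.cos (2 * θ) := by
    rcases hθ with hθ | hθ
    · exact ⟨Real.sin_nonneg_of_nonneg_of_le_pi hθ.1 (by linarith [hθ.2]),
        Real.cos_nonneg_of_mem_Icc ⟨by linarith [hθ.1], by linarith [hθ.2]⟩⟩
    · refine ⟨Real.sin_nonneg_of_nonneg_of_le_pi (by linarith [hθ.1]) hθ.2, ?_⟩
      rw [← Real.cos_sub_two_pi]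
      exact Real.cos_nonneg_of_mem_Icc ⟨by linarith [hθ.1], by linarith [hθ.2]⟩
  rw [Real.cos_two_mul'] at h
  rw [(polar_re_im r θ).1, (polar_re_im r θ).2, mul_pow, mul_pow]
  exact ⟨mul_le_mul_of_nonneg_left (by linarith [h.2]) (sq_nonneg r), mul_nonneg hr h.1⟩

/-- A holomorphic function with exponential decay on the closed sector integrates to zero
along `∂D_R⁺`. -/
lemma plusIntegral_eq_zero {F : ℂ → ℂ} {R C c : ℝ} (hR : 0 < R) (hc : 0 < c)
    (hd : ∀ ν ∈ upperSector R, DifferentiableAt ℂ F ν)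
    (hb : ∀ ν ∈ upperSector R, ‖F ν‖ ≤ decay C c ‖ν‖) :
    PlusIntegrable R F ∧ plusIntegral R F = 0 := by
  have hπ := Real.pi_pos
  have hd' : ∀ r ≥ R, ∀ θ ∈ Icc (Real.pi / 4) (3 * Real.pi / 4),
      DifferentiableAt ℂ F (r * Complex.exp (θ * Complex.I)) :=
    fun r hr θ hθ => hd _ (polar_mem_upperSector hR hr hθ)
  have hb' : ∀ r ≥ R, ∀ θ ∈ Icc (Real.pi / 4) (3 * Real.pi / 4),
      ‖F (r * Complex.exp (θ * Complex.I))‖ ≤ decay C c r := by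
    intro r hr θ hθ
    have := hb _ (polar_mem_upperSector hR hr hθ)
    rwa [norm_mul_exp_mul_I (hR.le.trans hr)] at this
  exact ⟨sectorBoundaryIntegrable_of_decay (by linarith) hc
    (fun r hr θ hθ => (hd' r hr θ hθ).continuousAt) hb',
    sectorBoundaryIntegral_eq_zero (by linarith) hR hc hd' hb'⟩

/-- Absolute convergence along `∂D_R⁺` only involves decay on the two rays `Re ν² = 0`. -/
lemma plusIntegrable_of_decay {F : ℂ → ℂ} {R C c : ℝ} (hR : 0 < R) (hc : 0 < c)
    (hF : Continuous F) (hb : ∀ ν ∈ upperSector R, (ν ^ 2).re = 0 → ‖F ν‖ ≤ decay C c ‖ν‖) :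
    PlusIntegrable R F := by
  have hπ := Real.pi_pos
  have ray : ∀ θ ∈ Icc (Real.pi / 4) (3 * Real.pi / 4), Real.cos (2 * θ) = 0 →
      IntegrableOn (fun r : ℝ => F (r * Complex.exp (θ * Complex.I))) (Ioi R) := by
    intro θ hθ h2
    refine integrableOn_ray hc (C := C) (fun r _ => hF.continuousAt) fun r hr => ?_
    have := hb _ (polar_mem_upperSector hR hr hθ) ?_
    · rwa [norm_mul_exp_mul_I (hR.le.trans hr)] at this
    · rw [Real.cos_two_mul'] at h2
      rw [sq_re_eq, (polar_re_im r θ).1, (polar_re_im r θ).2]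
      linear_combination r ^ 2 * h2
  refine ⟨ray _ ⟨le_rfl, by linarith⟩ ?_, ray _ ⟨by linarith, le_rfl⟩ ?_,
    Continuous.intervalIntegrable (by fun_prop) _ _⟩
  · rw [show 2 * (Real.pi / 4) = Real.pi / 2 by ring, Real.cos_pi_div_two]
  · rw [show 2 * (3 * Real.pi / 4) = Real.pi / 2 + Real.pi by ring, Real.cos_add_pi,
      Real.cos_pi_div_two, neg_zero]

lemma PlusIntegrable.congr {F G : ℂ → ℂ} {R : ℝ} (hR : 0 < R)
    (h : ∀ ν ∈ upperSector R, F ν = G ν) (hF : PlusIntegrable R F) : PlusIntegrable R G := by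
  have hπ := Real.pi_pos
  refine ⟨hF.1.congr_fun (fun r hr => h _ (polar_mem_upperSector hR (le_of_lt hr)
      ⟨le_rfl, by linarith⟩)) measurableSet_Ioi,
    hF.2.1.congr_fun (fun r hr => h _ (polar_mem_upperSector hR (le_of_lt hr)
      ⟨by linarith, le_rfl⟩)) measurableSet_Ioi, hF.2.2.congr fun θ hθ => ?_⟩
  rw [uIoc_of_le (by linarith)] at hθ
  exact h _ (polar_mem_upperSector hR le_rfl ⟨hθ.1.le, hθ.2⟩)

lemma plusIntegral_congr {F G : ℂ → ℂ} {R : ℝ} (hR : 0 < R)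
    (h : ∀ ν ∈ upperSector R, F ν = G ν) : plusIntegral R F = plusIntegral R G := by
  have hπ := Real.pi_pos
  simp only [plusIntegral, sectorBoundaryIntegral]
  congr 1
  · congr 1
    · congr 1
      refine setIntegral_congr_fun measurableSet_Ioi fun r hr => ?_
      rw [h _ (polar_mem_upperSector hR (le_of_lt hr) ⟨by linarith, le_rfl⟩)]
    · refine intervalIntegral.integral_congr fun θ hθ => ?_
      rw [uIcc_of_ge (by linarith)] at hθ
      rw [h _ (polar_mem_upperSector hR le_rfl hθ)]
  · refine setIntegral_congr_fun measurableSet_Ioi fun r hr => ?_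
    rw [h _ (polar_mem_upperSector hR (le_of_lt hr) ⟨le_rfl, by linarith⟩)]

lemma PlusIntegrable.sub {F G : ℂ → ℂ} {R : ℝ} (hF : PlusIntegrable R F)
    (hG : PlusIntegrable R G) : PlusIntegrable R (fun ν => F ν - G ν) :=
  ⟨hF.1.sub hG.1, hF.2.1.sub hG.2.1, hF.2.2.sub hG.2.2⟩

lemma plusIntegral_sub {F G : ℂ → ℂ} {R : ℝ} (hF : PlusIntegrable R F)
    (hG : PlusIntegrable R G) :
    plusIntegral R (fun ν => F ν - G ν) = plusIntegral R F - plusIntegral R G := by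
  have arc : ∀ H : ℂ → ℂ, PlusIntegrable R H → IntervalIntegrable (fun θ : ℝ =>
      H (R * Complex.exp (θ * Complex.I)) * (R * Complex.I * Complex.exp (θ * Complex.I)))
      volume (3 * Real.pi / 4) (Real.pi / 4) := fun H hH =>
    hH.2.2.symm.mul_continuousOn (by fun_prop)
  simp only [plusIntegral, sectorBoundaryIntegral, sub_mul]
  rw [integral_sub (hF.2.1.mul_const _) (hG.2.1.mul_const _),
    integral_sub (hF.1.mul_const _) (hG.1.mul_const _),
    intervalIntegral.integral_sub (arc F hF) (arc G hG)]
  ring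

lemma exp_sub_pi_mul_I (θ : ℝ) :
    Complex.exp (((θ - Real.pi : ℝ) : ℂ) * Complex.I) = -Complex.exp (θ * Complex.I) := by
  rw [Complex.ofReal_sub, sub_mul, Complex.exp_sub, Complex.exp_pi_mul_I, div_neg, div_one]

/-- The half turn `ν ↦ -ν` exchanges `∂D_R⁺` and `∂D_R⁻`, with their orientations. -/
lemma minusIntegral_eq (R : ℝ) (F : ℂ → ℂ) :
    minusIntegral R F = -plusIntegral R (fun ν => F (-ν)) := by
  have e1 := exp_sub_pi_mul_I (Real.pi / 4)
  have e2 := exp_sub_pi_mul_I (3 * Real.pi / 4)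
  rw [show Real.pi / 4 - Real.pi = -(3 * Real.pi / 4) by ring] at e1
  rw [show 3 * Real.pi / 4 - Real.pi = -(Real.pi / 4) by ring] at e2
  have e3 := intervalIntegral.integral_comp_sub_right (a := 3 * Real.pi / 4) (b := Real.pi / 4)
    (fun θ : ℝ => F (R * Complex.exp (θ * Complex.I)) *
        (R * Complex.I * Complex.exp (θ * Complex.I))) Real.pi
  rw [show Real.pi / 4 - Real.pi = -(3 * Real.pi / 4) by ring,
    show 3 * Real.pi / 4 - Real.pi = -(Real.pi / 4) by ring] at e3
  simp only [minusIntegral, plusIntegral, sectorBoundaryIntegral]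
  rw [← e3, e1, e2]
  simp only [exp_sub_pi_mul_I, mul_neg, integral_neg, intervalIntegral.integral_neg]
  ring

lemma minusIntegrable_iff (R : ℝ) (F : ℂ → ℂ) :
    MinusIntegrable R F ↔ PlusIntegrable R (fun ν => F (-ν)) := by
  have e1 := exp_sub_pi_mul_I (Real.pi / 4)
  have e2 := exp_sub_pi_mul_I (3 * Real.pi / 4)
  rw [show Real.pi / 4 - Real.pi = -(3 * Real.pi / 4) by ring] at e1
  rw [show 3 * Real.pi / 4 - Real.pi = -(Real.pi / 4) by ring] at e2
  have e3 := IntervalIntegrable.comp_sub_right_iff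
    (f := fun θ : ℝ => F (R * Complex.exp (θ * Complex.I)))
    (a := -(3 * Real.pi / 4)) (b := -(Real.pi / 4)) (c := Real.pi)
  rw [show -(3 * Real.pi / 4) + Real.pi = Real.pi / 4 by ring,
    show -(Real.pi / 4) + Real.pi = 3 * Real.pi / 4 by ring] at e3
  simp only [MinusIntegrable, PlusIntegrable, SectorBoundaryIntegrable]
  rw [e1, e2, ← e3]
  simp only [exp_sub_pi_mul_I, mul_neg]

/-! ### The linear system -/

namespace Wall

lemma σext_castSucc (W : Wall n) (j : Fin (n + 1)) : W.σext j.castSucc = W.σ j := by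
  simp [σext]

lemma σext_last (W : Wall n) : W.σext (Fin.last (n + 1)) = W.σ (Fin.last n) := by
  simp [σext]

lemma σext_pos (W : Wall n) (i : Fin (n + 2)) : 0 < W.σext i := by
  induction i using Fin.lastCases with
  | last => rw [σext_last]; exact W.σ_pos _
  | cast j => rw [σext_castSucc]; exact W.σ_pos _

lemma left_lt_right (W : Wall n) (j : Fin (n + 1)) : W.left j < W.right j :=
  W.x_strictMono (Fin.castSucc_lt_succ)

lemma σ_ne (W : Wall n) (j : Fin (n + 1)) : (W.σ j : ℂ) ≠ 0 :=
  Complex.ofReal_ne_zero.2 (W.σ_pos j).ne'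

lemma phase_add (W : Wall n) (j : Fin (n + 1)) (p q : ℝ) (ν : ℂ) :
    W.phase j p ν * W.phase j q (-ν) = W.phase j (p - q) ν := by
  simp only [phase]
  rw [← Complex.exp_add]
  congr 1
  push_cast
  ring

lemma phase_zero (W : Wall n) (j : Fin (n + 1)) (ν : ℂ) : W.phase j 0 ν = 1 := by
  simp [phase]

lemma norm_phase (W : Wall n) (j : Fin (n + 1)) (p : ℝ) (ν : ℂ) :
    ‖W.phase j p ν‖ = Real.exp (-(ν.im * (p / W.σ j))) := by
  rw [phase, Complex.norm_exp]
  congr 1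
  rw [show Complex.I * ν * p / W.σ j = Complex.I * ν * ((p / W.σ j : ℝ) : ℂ) by push_cast; ring]
  simp

lemma pair_dotProduct {ι : Type*} [Fintype ι] [DecidableEq ι] (i k : ι) (a c : ℂ) (v : ι → ℂ) :
    (fun j => (Pi.single i a : ι → ℂ) j + (Pi.single k c : ι → ℂ) j) ⬝ᵥ v = a * v i + c * v k := by
  rw [← single_dotProduct, ← single_dotProduct v c k, ← add_dotProduct]
  rfl

/-- The system `A(ν) X = b`, row by row. -/
lemma mulVec_A_iff (W : Wall n) (ν : ℂ) (X b : Fin (n + 2) ⊕ Fin (n + 2) → ℂ) :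
    (W.A ν).mulVec X = b ↔
      W.β₁ * X (Sum.inl 0) + W.β₂ * X (Sum.inr 0) = b (Sum.inl 0) ∧
      (∀ j : Fin (n + 1), W.phase j (W.right j) (-ν) *
          ((W.σext j.succ : ℂ) ^ 2 * X (Sum.inr j.succ)
            + Complex.I * W.σ j * ν * X (Sum.inl j.succ))
        - W.phase j (W.left j) (-ν) * ((W.σ j : ℂ) ^ 2 * X (Sum.inr j.castSucc)
            + Complex.I * W.σ j * ν * X (Sum.inl j.castSucc)) = b (Sum.inl j.succ)) ∧
      (∀ j : Fin (n + 1), W.phase j (W.right j) ν *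
          ((W.σext j.succ : ℂ) ^ 2 * X (Sum.inr j.succ)
            - Complex.I * W.σ j * ν * X (Sum.inl j.succ))
        - W.phase j (W.left j) ν * ((W.σ j : ℂ) ^ 2 * X (Sum.inr j.castSucc)
            - Complex.I * W.σ j * ν * X (Sum.inl j.castSucc)) = b (Sum.inr j.castSucc)) ∧
      W.β₃ * X (Sum.inl (Fin.last (n + 1))) + W.β₄ * X (Sum.inr (Fin.last (n + 1)))
        = b (Sum.inr (Fin.last (n + 1))) := by
  have e : (W.A ν).mulVec X = Sum.elim
      ((W.A₁₁ ν).mulVec (X ∘ Sum.inl) + (W.A₁₂ ν).mulVec (X ∘ Sum.inr))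
      ((W.A₂₁ ν).mulVec (X ∘ Sum.inl) + (W.A₂₂ ν).mulVec (X ∘ Sum.inr)) := by
    rw [A, Matrix.fromBlocks_mulVec]
  rw [e, funext_iff, Sum.forall, Fin.forall_fin_succ, Fin.forall_fin_succ' (P := fun i =>
    Sum.elim _ _ (Sum.inr i) = b (Sum.inr i)), and_assoc]
  simp only [Sum.elim_inl, Sum.elim_inr, Pi.add_apply, Matrix.mulVec, A₁₁, A₁₂, A₂₁, A₂₂,
    Matrix.of_apply, Fin.cons_zero, Fin.cons_succ, Fin.snoc_castSucc, Fin.snoc_last,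
    pair_dotProduct, single_dotProduct, Function.comp]
  refine and_congr Iff.rfl (and_congr (forall_congr' fun j => ?_)
    (and_congr (forall_congr' fun j => ?_) Iff.rfl))
  · rw [← sub_eq_zero, ← sub_eq_zero (b := b _)]
    ring_nf
  · rw [← sub_eq_zero, ← sub_eq_zero (b := b _)]
    ring_nf

/-- At an end of the wall the boundary condition is inverted uniformly for large `|ν|`. -/
lemma exists_bound_boundary_node {β β' τ : ℝ} (hβ : β ≠ 0 ∨ β' ≠ 0) (hτ : τ ≠ 0) :
    ∃ K > 0, ∃ R > 0, ∀ ν G₀ G₁ : ℂ, R ≤ ‖ν‖ → β * G₀ + β' * (Complex.I * ν) * G₁ = 0 →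
      ‖G₀‖ ≤ K * ‖G₁ + τ * G₀‖ ∧ ‖G₁‖ ≤ K * ‖G₁ + τ * G₀‖ := by
  have hτ' : 0 < |τ| := abs_pos.2 hτ
  by_cases hb : β' = 0
  · have hβ0 : β ≠ 0 := hβ.resolve_right (not_not.2 hb)
    refine ⟨1, one_pos, 1, one_pos, fun ν G₀ G₁ _ h => ?_⟩
    have h0 : G₀ = 0 := by simpa [hb, hβ0] using h
    simp [h0]
  · have hb' : 0 < |β'| := abs_pos.2 hb
    refine ⟨2 / |τ| + 1, by positivity, 2 * |β| / (|β'| * |τ|) + 1, by positivity,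
      fun ν G₀ G₁ hν h => ?_⟩
    have h1 : |β'| * ‖ν‖ * ‖G₁‖ = |β| * ‖G₀‖ := by
      have : β' * (Complex.I * ν) * G₁ = -(β * G₀) := by linear_combination h
      simpa using congrArg norm this
    have h2 : 2 * |β| ≤ ‖ν‖ * (|β'| * |τ|) := by
      rw [← div_le_iff₀ (by positivity)]; linarith
    have hν0 : 0 < ‖ν‖ := lt_of_lt_of_le (by positivity) hν
    have h3 : ‖G₁‖ ≤ |τ| / 2 * ‖G₀‖ := by
      have : |β'| * ‖ν‖ * ‖G₁‖ ≤ |β'| * ‖ν‖ * (|τ| / 2 * ‖G₀‖) := by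
        rw [h1]; nlinarith [norm_nonneg G₀]
      exact le_of_mul_le_mul_left this (by positivity)
    have h4 : |τ| * ‖G₀‖ ≤ ‖G₁ + τ * G₀‖ + ‖G₁‖ := by
      have := norm_sub_le (G₁ + τ * G₀) G₁
      rw [add_sub_cancel_left, norm_mul, Complex.norm_real, Real.norm_eq_abs] at this
      exact this
    have h5 : |τ| / 2 * ‖G₀‖ ≤ ‖G₁ + τ * G₀‖ := by linarith
    have h6 : ‖G₀‖ ≤ 2 / |τ| * ‖G₁ + τ * G₀‖ := by
      rw [div_mul_eq_mul_div, le_div_iff₀ hτ']; linarith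
    have h7 : 0 ≤ 2 / |τ| * ‖G₁ + τ * G₀‖ := by positivity
    exact ⟨by linarith [norm_nonneg (G₁ + τ * G₀)], by linarith⟩

lemma bound_interior_node {σ σ' N : ℝ} (hσ : 0 < σ) (hσ' : 0 < σ') {G₀ G₁ : ℂ}
    (h : ‖G₁ + σ * G₀‖ ≤ N) (h' : ‖G₁ - σ' * G₀‖ ≤ N) :
    ‖G₀‖ ≤ (2 / (σ + σ') + 3) * N ∧ ‖G₁‖ ≤ (2 / (σ + σ') + 3) * N := by
  have hN : 0 ≤ N := (norm_nonneg _).trans h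
  have h1 : (σ + σ') * ‖G₀‖ ≤ 2 * N := by
    have := norm_sub_le (G₁ + σ * G₀) (G₁ - σ' * G₀)
    rw [show G₁ + σ * G₀ - (G₁ - σ' * G₀) = ((σ + σ' : ℝ) : ℂ) * G₀ by push_cast; ring, norm_mul,
      Complex.norm_real, Real.norm_of_nonneg (by positivity)] at this
    linarith
  have h2 : ‖G₀‖ ≤ 2 / (σ + σ') * N := by
    rw [div_mul_eq_mul_div, le_div_iff₀ (by positivity)]; linarith
  have h3 : ‖G₁‖ ≤ N + σ * ‖G₀‖ := by
    have := norm_sub_le (G₁ + σ * G₀) (σ * G₀)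
    rw [add_sub_cancel_right, norm_mul, Complex.norm_real, Real.norm_of_nonneg hσ.le] at this
    linarith
  have h4 : 0 ≤ 2 / (σ + σ') * N := by positivity
  have h5 : 0 ≤ σ' * ‖G₀‖ := by positivity
  exact ⟨by linarith, by linarith⟩

/-- The scaled traces `iν g₀` of the temperature. -/
def scaled₀ (X : Fin (n + 2) ⊕ Fin (n + 2) → ℂ) (ν : ℂ) (i : Fin (n + 2)) : ℂ :=
  Complex.I * ν * X (Sum.inl i)

/-- The scaled traces `σ² g₁`, the heat fluxes. -/
def scaled₁ (W : Wall n) (X : Fin (n + 2) ⊕ Fin (n + 2) → ℂ) (i : Fin (n + 2)) : ℂ :=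
  (W.σext i : ℂ) ^ 2 * X (Sum.inr i)

/-- The homogeneous boundary conditions at both ends of the wall. -/
def HomogeneousEnds (W : Wall n) (X : Fin (n + 2) ⊕ Fin (n + 2) → ℂ) : Prop :=
  W.β₁ * X (Sum.inl 0) + W.β₂ * X (Sum.inr 0) = 0 ∧
  W.β₃ * X (Sum.inl (Fin.last (n + 1))) + W.β₄ * X (Sum.inr (Fin.last (n + 1))) = 0

/-- At each node, the two characteristic combinations `σ² g₁ ± iσν g₀` coming from the adjacent
layers (or one of them and the boundary condition) control both traces. -/
lemma exists_bound_nodes (W : Wall n) :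
    ∃ K > 0, ∃ R > 0, ∀ (ν : ℂ) (X : Fin (n + 2) ⊕ Fin (n + 2) → ℂ) (N : ℝ), R ≤ ‖ν‖ →
      W.HomogeneousEnds X →
      (∀ j : Fin (n + 1), ‖W.scaled₁ X j.succ + W.σ j * scaled₀ X ν j.succ‖ ≤ N) →
      (∀ j : Fin (n + 1), ‖W.scaled₁ X j.castSucc - W.σ j * scaled₀ X ν j.castSucc‖ ≤ N) →
      ∀ i, ‖scaled₀ X ν i‖ ≤ K * N ∧ ‖W.scaled₁ X i‖ ≤ K * N := by
  have scale : ∀ (i : Fin (n + 2)) (β β' : ℝ) (ν : ℂ) (X : Fin (n + 2) ⊕ Fin (n + 2) → ℂ),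
      β * X (Sum.inl i) + β' * X (Sum.inr i) = 0 →
      (β : ℂ) * scaled₀ X ν i + ((β' / W.σext i ^ 2 : ℝ) : ℂ) * (Complex.I * ν) * W.scaled₁ X i
        = 0 := by
    intro i β β' ν X h
    have hs : (W.σext i : ℂ) ≠ 0 := Complex.ofReal_ne_zero.2 (W.σext_pos i).ne'
    simp only [scaled₀, scaled₁]
    push_cast
    field_simp
    linear_combination Complex.I * ν * h
  have scale_ne : ∀ (i : Fin (n + 2)) (β β' : ℝ), β ≠ 0 ∨ β' ≠ 0 →
      β ≠ 0 ∨ β' / W.σext i ^ 2 ≠ 0 := fun i β β' h =>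
    h.imp_right fun h => div_ne_zero h (pow_pos (W.σext_pos i) 2).ne'
  have node : ∀ i : Fin (n + 2), ∃ K > 0, ∃ R > 0, ∀ (ν : ℂ)
      (X : Fin (n + 2) ⊕ Fin (n + 2) → ℂ) (N : ℝ), R ≤ ‖ν‖ → W.HomogeneousEnds X →
      (∀ j : Fin (n + 1), ‖W.scaled₁ X j.succ + W.σ j * scaled₀ X ν j.succ‖ ≤ N) →
      (∀ j : Fin (n + 1), ‖W.scaled₁ X j.castSucc - W.σ j * scaled₀ X ν j.castSucc‖ ≤ N) →
      ‖scaled₀ X ν i‖ ≤ K * N ∧ ‖W.scaled₁ X i‖ ≤ K * N := by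
    intro i
    induction i using Fin.cases with
    | zero =>
      obtain ⟨K, hK, R, hR, h⟩ := exists_bound_boundary_node (scale_ne 0 _ _ W.left_ne)
        (neg_ne_zero.2 (W.σ_pos 0).ne')
      refine ⟨K, hK, R, hR, fun ν X N hν hX _ hV => ?_⟩
      have h1 := h ν _ _ hν (scale 0 _ _ ν X hX.1)
      have h2 : ‖W.scaled₁ X 0 + ((-W.σ 0 : ℝ) : ℂ) * scaled₀ X ν 0‖ ≤ N := by
        have := hV 0
        rw [Fin.castSucc_zero] at this
        rwa [Complex.ofReal_neg, neg_mul, ← sub_eq_add_neg]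
      have h3 := mul_le_mul_of_nonneg_left h2 hK.le
      exact ⟨h1.1.trans h3, h1.2.trans h3⟩
    | succ i =>
      induction i using Fin.lastCases with
      | last =>
        obtain ⟨K, hK, R, hR, h⟩ := exists_bound_boundary_node
          (scale_ne (Fin.last (n + 1)) _ _ W.right_ne) (W.σ_pos (Fin.last n)).ne'
        refine ⟨K, hK, R, hR, fun ν X N hν hX hU _ => ?_⟩
        have h1 := h ν _ _ hν (scale (Fin.last (n + 1)) _ _ ν X hX.2)
        have h3 := mul_le_mul_of_nonneg_left (hU (Fin.last n)) hK.le
        rw [Fin.succ_last] at h3 ⊢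
        exact ⟨h1.1.trans h3, h1.2.trans h3⟩
      | cast i =>
        have hs := W.σ_pos i.castSucc
        have hs' := W.σ_pos i.succ
        refine ⟨2 / (W.σ i.castSucc + W.σ i.succ) + 3, by positivity, 1, one_pos,
          fun ν X N _ _ hU hV => ?_⟩
        refine bound_interior_node hs hs' (hU i.castSucc) ?_
        rw [Fin.succ_castSucc]
        exact hV i.succ
  choose K hK R hR h using node
  refine ⟨∑ i, K i, Finset.sum_pos (fun i _ => hK i) Finset.univ_nonempty, ∑ i, R i,
    Finset.sum_pos (fun i _ => hR i) Finset.univ_nonempty, fun ν X N hν hX hU hV i => ?_⟩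
  have hN : 0 ≤ N := (norm_nonneg _).trans (hU 0)
  have hRi : R i ≤ ‖ν‖ :=
    (Finset.single_le_sum (fun i _ => (hR i).le) (Finset.mem_univ i)).trans hν
  have hKi : K i * N ≤ (∑ i, K i) * N := mul_le_mul_of_nonneg_right
    (Finset.single_le_sum (fun i _ => (hK i).le) (Finset.mem_univ i)) hN
  have h1 := h i ν X N hRi hX hU hV
  exact ⟨h1.1.trans hKi, h1.2.trans hKi⟩

/-- Uniform inversion of the system in `ℂ⁺`.  After scaling row `j` by `e^{± iν x/σ_j}`, neighbouring
nodes are coupled only through `e^{iν(x_j - x_{j-1})/σ_j}`, which is exponentially small in the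
closed sector, so that the coupling is absorbed for large `|ν|`. -/
lemma exists_bound_solution (W : Wall n) :
    ∃ K > 0, ∃ R > 0, ∀ ν ∈ upperSector R, ∀ (X : Fin (n + 2) ⊕ Fin (n + 2) → ℂ) (B : ℝ)
      (p q : Fin (n + 1) → ℂ), W.HomogeneousEnds X →
      (∀ j, W.scaled₁ X j.succ + W.σ j * scaled₀ X ν j.succ
        = p j + W.phase j (W.right j - W.left j) ν *
          (W.scaled₁ X j.castSucc + W.σ j * scaled₀ X ν j.castSucc)) →
      (∀ j, W.scaled₁ X j.castSucc - W.σ j * scaled₀ X ν j.castSucc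
        = q j + W.phase j (W.right j - W.left j) ν *
          (W.scaled₁ X j.succ - W.σ j * scaled₀ X ν j.succ)) →
      (∀ j, ‖p j‖ ≤ B) → (∀ j, ‖q j‖ ≤ B) →
      ∀ i, ‖scaled₀ X ν i‖ ≤ K * B ∧ ‖W.scaled₁ X i‖ ≤ K * B := by
  obtain ⟨K, hK, R₁, hR₁, hnode⟩ := W.exists_bound_nodes
  have small : ∀ j : Fin (n + 1), ∀ᶠ R : ℝ in atTop,
      Real.exp (-(R / 2 * ((W.right j - W.left j) / W.σ j))) * (K * (1 + W.σ j)) < 1 / 2 := by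
    intro j
    have hd : 0 < (W.right j - W.left j) / W.σ j :=
      div_pos (sub_pos.2 (W.left_lt_right j)) (W.σ_pos j)
    have h1 : Tendsto (fun R : ℝ => R / 2 * ((W.right j - W.left j) / W.σ j)) atTop atTop :=
      (tendsto_id.atTop_div_const two_pos).atTop_mul_const hd
    have h2 := (Real.tendsto_exp_neg_atTop_nhds_zero.comp h1).mul_const (K * (1 + W.σ j))
    rw [zero_mul] at h2
    exact h2.eventually (gt_mem_nhds (by norm_num))
  obtain ⟨R, hsmall, hR⟩ := ((eventually_all.2 small).and (eventually_ge_atTop R₁)).exists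
  refine ⟨2 * K, by positivity, R, hR₁.trans_le hR, fun ν hν X B p q hX hU hV hp hq => ?_⟩
  set U : Fin (n + 1) → ℂ := fun j => W.scaled₁ X j.succ + W.σ j * scaled₀ X ν j.succ with hUdef
  set V : Fin (n + 1) → ℂ := fun j => W.scaled₁ X j.castSucc - W.σ j * scaled₀ X ν j.castSucc
    with hVdef
  set N := ‖(U, V)‖ with hNdef
  have hN : 0 ≤ N := norm_nonneg _
  have hB : 0 ≤ B := (norm_nonneg _).trans (hp 0)
  have hUN : ∀ j, ‖U j‖ ≤ N := fun j => (norm_le_pi_norm U j).trans (norm_fst_le (U, V))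
  have hVN : ∀ j, ‖V j‖ ≤ N := fun j => (norm_le_pi_norm V j).trans (norm_snd_le (U, V))
  have hG := hnode ν X N (hR.trans hν.2.2) hX hUN hVN
  have half : ∀ (j : Fin (n + 1)) (w : ℂ), ‖w‖ ≤ K * (1 + W.σ j) * N →
      ‖W.phase j (W.right j - W.left j) ν * w‖ ≤ N / 2 := by
    intro j w hw
    have hd : 0 < (W.right j - W.left j) / W.σ j :=
      div_pos (sub_pos.2 (W.left_lt_right j)) (W.σ_pos j)
    have him : R / 2 ≤ ν.im := by linarith [upperSector_im hν, hν.2.2]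
    rw [norm_mul, norm_phase]
    calc Real.exp (-(ν.im * ((W.right j - W.left j) / W.σ j))) * ‖w‖
        ≤ Real.exp (-(R / 2 * ((W.right j - W.left j) / W.σ j))) * (K * (1 + W.σ j) * N) := by
          gcongr
      _ = Real.exp (-(R / 2 * ((W.right j - W.left j) / W.σ j))) * (K * (1 + W.σ j)) * N := by
          ring
      _ ≤ 1 / 2 * N := mul_le_mul_of_nonneg_right (hsmall j).le hN
      _ = N / 2 := by ring
  have hcomb : ∀ (j : Fin (n + 1)) (i : Fin (n + 2)),
      ‖W.σ j * scaled₀ X ν i‖ + ‖W.scaled₁ X i‖ ≤ K * (1 + W.σ j) * N := by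
    intro j i
    rw [norm_mul, Complex.norm_real, Real.norm_of_nonneg (W.σ_pos j).le]
    have := mul_le_mul_of_nonneg_left (hG i).1 (W.σ_pos j).le
    linarith [(hG i).2]
  have hNB : N ≤ B + N / 2 := by
    rw [hNdef, Prod.norm_def]
    refine max_le ((pi_norm_le_iff_of_nonneg (by positivity)).2 fun j => ?_)
      ((pi_norm_le_iff_of_nonneg (by positivity)).2 fun j => ?_)
    · simp only [hUdef]
      rw [hU j]
      refine (norm_add_le _ _).trans (add_le_add (hp j) (half j _ ?_))
      refine (norm_add_le _ _).trans ?_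
      rw [add_comm]; exact hcomb j _
    · simp only [hVdef]
      rw [hV j]
      refine (norm_add_le _ _).trans (add_le_add (hq j) (half j _ ?_))
      refine (norm_sub_le _ _).trans ?_
      rw [add_comm]; exact hcomb j _
  have hfin : K * N ≤ 2 * K * B := by
    have : N ≤ 2 * B := by linarith
    nlinarith
  intro i
  exact ⟨(hG i).1.trans hfin, (hG i).2.trans hfin⟩

end Wall

lemma _root_.Differentiable.matrix_det {ι : Type*} [Fintype ι] [DecidableEq ι]
    {M : ℂ → Matrix ι ι ℂ} (h : ∀ i j, Differentiable ℂ fun z => M z i j) :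
    Differentiable ℂ fun z => (M z).det := by
  simp only [Matrix.det_apply]
  refine Differentiable.fun_sum fun σ _ => Differentiable.fun_const_smul ?_ _
  exact Differentiable.fun_finsetProd fun i _ => h _ _

/-- Cramer's rule for a solution that is already given. -/
lemma eq_det_updateCol_div {ι : Type*} [Fintype ι] [DecidableEq ι] {M : Matrix ι ι ℂ}
    {v b : ι → ℂ} (hM : M.det ≠ 0) (h : M.mulVec v = b) (i : ι) :
    v i = (M.updateCol i b).det / M.det := by
  rw [eq_div_iff hM, ← Matrix.cramer_apply, Matrix.cramer_eq_adjugate_mulVec, ← h,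
    Matrix.mulVec_mulVec, Matrix.adjugate_mul, Matrix.smul_mulVec, Matrix.one_mulVec,
    Pi.smul_apply, smul_eq_mul, mul_comm]

/-! ### Transforms and contour integrands -/

lemma intervalIntegrable_exp_mul {f : ℝ → ℝ} {a b : ℝ} (hf : IntervalIntegrable f volume a b)
    (w : ℂ) : IntervalIntegrable (fun s : ℝ => Complex.exp (w * s) * (f s : ℂ)) volume a b :=
  IntervalIntegrable.continuousOn_mul (f := fun s => (f s : ℂ))
    ⟨hf.1.ofReal, hf.2.ofReal⟩ (by fun_prop)

/-- Exponential transforms over bounded intervals are entire. -/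
lemma differentiable_expTransform {f : ℝ → ℝ} {a b : ℝ} (hf : IntervalIntegrable f volume a b)
    (c : ℂ) : Differentiable ℂ fun z : ℂ => ∫ s in a..b, Complex.exp (c * z * s) * (f s : ℂ) := by
  intro z₀
  set M := max |a| |b|
  have hM : 0 ≤ M := (abs_nonneg a).trans (le_max_left _ _)
  have hs : ∀ s ∈ uIoc a b, |s| ≤ M := fun s hs => by
    rcases le_total a b with h | h
    · rw [uIoc_of_le h] at hs
      exact abs_le_max_abs_abs hs.1.le hs.2
    · rw [uIoc_of_ge h] at hs
      rw [show M = max |b| |a| from max_comm _ _]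
      exact abs_le_max_abs_abs hs.1.le hs.2
  refine (intervalIntegral.hasDerivAt_integral_of_dominated_loc_of_deriv_le
    (F' := fun z s => c * s * (Complex.exp (c * z * s) * (f s : ℂ)))
    (bound := fun s => ‖c‖ * M * Real.exp (‖c‖ * (‖z₀‖ + 1) * M) * |f s|)
    (Metric.ball_mem_nhds z₀ one_pos) ?_ ?_ ?_ ?_ ?_ ?_).2.differentiableAt
  · exact Eventually.of_forall fun z => (intervalIntegrable_exp_mul hf _).def'.aestronglyMeasurable
  · exact intervalIntegrable_exp_mul hf _
  · exact ((intervalIntegrable_exp_mul hf _).continuousOn_mul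
      (g := fun s : ℝ => c * s) (by fun_prop)).def'.aestronglyMeasurable
  · refine Eventually.of_forall fun s hsm z hz => ?_
    have hz' : ‖z‖ ≤ ‖z₀‖ + 1 := by
      have := norm_sub_norm_le z z₀
      rw [mem_ball_iff_norm] at hz
      linarith
    have h1 : ‖Complex.exp (c * z * s)‖ ≤ Real.exp (‖c‖ * (‖z₀‖ + 1) * M) := by
      rw [Complex.norm_exp]
      refine Real.exp_le_exp.2 ((Complex.re_le_norm _).trans ?_)
      rw [norm_mul, norm_mul, Complex.norm_real, Real.norm_eq_abs]
      gcongr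
      exact hs s hsm
    rw [norm_mul, norm_mul, norm_mul, Complex.norm_real, Complex.norm_real, Real.norm_eq_abs,
      Real.norm_eq_abs, mul_assoc (‖c‖ * M)]
    gcongr
    exact hs s hsm
  · exact hf.abs.const_mul _
  · refine Eventually.of_forall fun s _ z _ => ?_
    have h1 : HasDerivAt (fun z : ℂ => c * z * s) (c * s) z := by
      simpa using ((hasDerivAt_id' z).const_mul c).mul_const (s : ℂ)
    exact (h1.cexp.mul_const _).congr_deriv (by ring)

lemma Wall.differentiable_hat (W : Wall n) (j : Fin (n + 1)) {v : ℝ → ℝ}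
    (hv : IntervalIntegrable v volume (W.left j) (W.right j)) : Differentiable ℂ (W.hat j v) :=
  differentiable_expTransform hv (-Complex.I)

lemma norm_exp_mul_expTransform_le {f : ℝ → ℝ} {a b t : ℝ} {w : ℂ} (hab : a ≤ b)
    (hf : IntervalIntegrable f volume a b) (h : ∀ s ∈ Ioc a b, w.re * (s - t) ≤ 0) :
    ‖Complex.exp (-(w * t)) * ∫ s in a..b, Complex.exp (w * s) * (f s : ℂ)‖
      ≤ ∫ s in a..b, |f s| := by
  rw [← intervalIntegral.integral_const_mul]
  refine intervalIntegral.norm_integral_le_of_norm_le hab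
    (Eventually.of_forall fun s hs => ?_) hf.abs
  rw [← mul_assoc, ← Complex.exp_add, norm_mul, Complex.norm_exp, Complex.norm_real,
    Real.norm_eq_abs]
  refine mul_le_of_le_one_left (abs_nonneg _) (Real.exp_le_one_iff.2 ?_)
  have := h s hs
  simp only [Complex.add_re, Complex.neg_re, Complex.mul_re, Complex.ofReal_re, Complex.ofReal_im,
    mul_zero, sub_zero]
  linarith

/-- The common shape of the two contour integrands, with `η > 0` the rescaled distance to the
relevant end of the layer; the contour `∂D_R⁻` is covered with `ν` replaced by `-ν`. -/
def contourTerm (η t : ℝ) (α τ : ℂ) (G₁ G₀ : ℂ → ℂ) (ν : ℂ) : ℂ :=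
  Complex.exp (Complex.I * ν * η - ν ^ 2 * t) * (α * G₁ ν + τ * (Complex.I * ν * G₀ ν))

lemma Wall.plusIntegrand_eq (W : Wall n) (X : ℂ → Fin (n + 2) ⊕ Fin (n + 2) → ℂ)
    (j : Fin (n + 1)) (y t : ℝ) : W.plusIntegrand X j y t =
      contourTerm ((y - W.left j) / W.σ j) t (W.σ j) 1 (fun ν => X ν (Sum.inr j.castSucc))
        (fun ν => X ν (Sum.inl j.castSucc)) := by
  ext ν
  rw [plusIntegrand, contourTerm, one_mul]
  congr 3
  push_cast
  ring

lemma Wall.minusIntegrand_neg_eq (W : Wall n) (X : ℂ → Fin (n + 2) ⊕ Fin (n + 2) → ℂ)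
    (j : Fin (n + 1)) (y t : ℝ) : (fun ν => W.minusIntegrand X j y t (-ν)) =
      contourTerm ((W.right j - y) / W.σ j) t ((W.σext j.succ : ℂ) ^ 2 / W.σ j) (-1)
        (fun ν => X (-ν) (Sum.inr j.succ)) (fun ν => X (-ν) (Sum.inl j.succ)) := by
  ext ν
  simp only [minusIntegrand, contourTerm]
  congr 2
  · push_cast
    ring
  · ring

lemma norm_exp_contour (η t : ℝ) (ν : ℂ) :
    ‖Complex.exp (Complex.I * ν * η - ν ^ 2 * t)‖
      = Real.exp (-(η * ν.im)) * Real.exp (-((ν ^ 2).re * t)) := by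
  rw [Complex.norm_exp, ← Real.exp_add]
  congr 1
  simp
  ring

lemma differentiable_contourTerm {η t : ℝ} {α τ : ℂ} {G₁ G₀ : ℂ → ℂ} (h₁ : Differentiable ℂ G₁)
    (h₀ : Differentiable ℂ G₀) : Differentiable ℂ (contourTerm η t α τ G₁ G₀) := by
  unfold contourTerm
  fun_prop

/-- Exponential decay of a contour term. Of the factor `e^{-ν² t}`, the part `e^{-ν² t'}` is spent on
bounding the transforms `G`; what remains, together with `e^{iνη}`, is assumed to decay. -/
lemma norm_contourTerm_le {η t c B₁ B₀ : ℝ} {α τ : ℂ} {G₁ G₀ : ℂ → ℂ} {ν : ℂ} {t' : ℝ}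
    (hc : Real.exp (-(η * ν.im)) * Real.exp (-((ν ^ 2).re * (t - t'))) ≤ Real.exp (-(c * ‖ν‖)))
    (h₁ : ‖Complex.exp (-(ν ^ 2 * t')) * G₁ ν‖ ≤ B₁)
    (h₀ : ‖Complex.exp (-(ν ^ 2 * t')) * G₀ ν‖ ≤ B₀) :
    ‖contourTerm η t α τ G₁ G₀ ν‖ ≤ decay (‖α‖ * B₁ + ‖τ‖ * B₀) c ‖ν‖ := by
  have hB₁ : 0 ≤ B₁ := (norm_nonneg _).trans h₁
  have hB₀ : 0 ≤ B₀ := (norm_nonneg _).trans h₀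
  have e : contourTerm η t α τ G₁ G₀ ν
      = Complex.exp (Complex.I * ν * η - ν ^ 2 * ((t - t' : ℝ) : ℂ)) *
        (α * (Complex.exp (-(ν ^ 2 * t')) * G₁ ν)
          + τ * (Complex.I * ν) * (Complex.exp (-(ν ^ 2 * t')) * G₀ ν)) := by
    rw [contourTerm, show Complex.I * ν * η - ν ^ 2 * t
      = (Complex.I * ν * η - ν ^ 2 * ((t - t' : ℝ) : ℂ)) + -(ν ^ 2 * t') by push_cast; ring,
      Complex.exp_add]
    ring
  rw [e, norm_mul, norm_exp_contour, decay, mul_comm]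
  refine mul_le_mul ?_ hc (by positivity) (by positivity)
  refine (norm_add_le _ _).trans ?_
  rw [norm_mul α, norm_mul (τ * _), norm_mul τ, norm_mul Complex.I, Complex.norm_I, one_mul]
  have i1 := mul_le_mul_of_nonneg_left h₁ (norm_nonneg α)
  have i2 := mul_le_mul_of_nonneg_left h₀ (mul_nonneg (norm_nonneg τ) (norm_nonneg ν))
  have i3 : 0 ≤ ‖τ‖ * B₀ := by positivity
  have i4 : 0 ≤ ‖α‖ * B₁ * ‖ν‖ := by positivity
  nlinarith

/-! ### The final-time temperature does not contribute -/

namespace Wall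

lemma differentiable_phase (W : Wall n) (j : Fin (n + 1)) (p : ℝ) :
    Differentiable ℂ (W.phase j p) := by
  unfold phase
  fun_prop

lemma differentiable_A (W : Wall n) (i k : Fin (n + 2) ⊕ Fin (n + 2)) :
    Differentiable ℂ fun ν => W.A ν i k := by
  have h1 := W.differentiable_phase
  have h2 : ∀ j p, Differentiable ℂ fun ν => W.phase j p (-ν) := fun j p =>
    (h1 j p).comp differentiable_neg
  rcases i with i | i
  · induction i using Fin.cases with
    | zero => rcases k with k | k <;> simp [A, A₁₁, A₁₂]
    | succ j =>
      rcases k with k | k <;>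
      · simp only [A, A₁₁, A₁₂, Matrix.fromBlocks_apply₁₁, Matrix.fromBlocks_apply₁₂,
          Matrix.of_apply, Fin.cons_succ, Pi.add_apply, Pi.single_apply]
        split_ifs <;> fun_prop
  · induction i using Fin.lastCases with
    | last => rcases k with k | k <;> simp [A, A₂₁, A₂₂]
    | cast j =>
      rcases k with k | k <;>
      · simp only [A, A₂₁, A₂₂, Matrix.fromBlocks_apply₂₁, Matrix.fromBlocks_apply₂₂,
          Matrix.of_apply, Fin.snoc_castSucc, Pi.add_apply, Pi.single_apply]
        split_ifs <;> fun_prop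

lemma differentiable_finalVector (W : Wall n) {u : Fin (n + 1) → ℝ → ℝ → ℝ} {T : ℝ}
    (hu : ∀ j, IntervalIntegrable (fun y => u j y T) volume (W.left j) (W.right j))
    (i : Fin (n + 2) ⊕ Fin (n + 2)) : Differentiable ℂ fun ν => W.finalVector u T ν i := by
  have h : ∀ j, Differentiable ℂ (W.hat j fun y => u j y T) :=
    fun j => W.differentiable_hat j (hu j)
  have h1 : ∀ j, Differentiable ℂ fun ν => W.hat j (fun y => u j y T) (ν / W.σ j) := fun j =>
    (h j).comp (by fun_prop)
  have h2 : ∀ j, Differentiable ℂ fun ν => W.hat j (fun y => u j y T) (-ν / W.σ j) := fun j =>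
    (h j).comp (by fun_prop)
  have he : Differentiable ℂ fun ν : ℂ => Complex.exp (ν ^ 2 * T) := by fun_prop
  rcases i with i | i
  · induction i using Fin.cases with
    | zero => simp [finalVector]
    | succ j =>
      simp only [finalVector, Sum.elim_inl, Fin.cons_succ]
      exact he.mul (h1 j)
  · induction i using Fin.lastCases with
    | last => simp [finalVector]
    | cast j =>
      simp only [finalVector, Sum.elim_inr, Fin.snoc_castSucc]
      exact he.mul (h2 j)

/-- The half turn `ν ↦ -ν` permutes the equations, so the solution is an even function of `ν`. -/
lemma mulVec_A_neg (W : Wall n) (ν : ℂ) (X b : Fin (n + 2) ⊕ Fin (n + 2) → ℂ)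
    (b' : Fin (n + 2) ⊕ Fin (n + 2) → ℂ) (h0 : b' (Sum.inl 0) = b (Sum.inl 0))
    (h1 : ∀ j : Fin (n + 1), b' (Sum.inl j.succ) = b (Sum.inr j.castSucc))
    (h2 : ∀ j : Fin (n + 1), b' (Sum.inr j.castSucc) = b (Sum.inl j.succ))
    (h3 : b' (Sum.inr (Fin.last (n + 1))) = b (Sum.inr (Fin.last (n + 1))))
    (h : (W.A (-ν)).mulVec X = b) : (W.A ν).mulVec X = b' := by
  rw [mulVec_A_iff] at h ⊢
  obtain ⟨e0, e1, e2, e3⟩ := h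
  refine ⟨by rw [h0, e0], fun j => ?_, fun j => ?_, by rw [h3, e3]⟩
  · rw [h1, ← e2 j]; ring
  · have := e1 j
    rw [neg_neg] at this
    rw [h2, ← this]; ring

lemma mulVec_A_neg_finalVector (W : Wall n) {ν : ℂ} {X : Fin (n + 2) ⊕ Fin (n + 2) → ℂ}
    {u : Fin (n + 1) → ℝ → ℝ → ℝ} {T : ℝ} (h : (W.A (-ν)).mulVec X = W.finalVector u T (-ν)) :
    (W.A ν).mulVec X = W.finalVector u T ν := by
  refine W.mulVec_A_neg ν X _ _ ?_ ?_ ?_ ?_ h <;> simp [finalVector]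

lemma phase_mul_left_right (W : Wall n) (j : Fin (n + 1)) (ν : ℂ) :
    W.phase j (W.right j) ν * W.phase j (W.right j) (-ν) = 1 ∧
    W.phase j (W.left j) ν * W.phase j (W.left j) (-ν) = 1 ∧
    W.phase j (W.right j) ν * W.phase j (W.left j) (-ν)
      = W.phase j (W.right j - W.left j) ν := by
  refine ⟨?_, ?_, W.phase_add j _ _ ν⟩ <;> rw [phase_add, sub_self, phase_zero]

/-- `exists_bound_solution` for a system `A(ν) X = b` with homogeneous boundary rows: the bound on `X`
involves the rows of `b` multiplied by their dominant phases. -/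
lemma exists_bound_mulVec (W : Wall n) :
    ∃ K > 0, ∃ R > 0, ∀ ν ∈ upperSector R, ∀ (X b : Fin (n + 2) ⊕ Fin (n + 2) → ℂ) (B : ℝ),
      (W.A ν).mulVec X = b → b (Sum.inl 0) = 0 → b (Sum.inr (Fin.last (n + 1))) = 0 →
      (∀ j : Fin (n + 1), ‖W.phase j (W.right j) ν * b (Sum.inl j.succ)‖ ≤ B) →
      (∀ j : Fin (n + 1), ‖W.phase j (W.left j) (-ν) * b (Sum.inr j.castSucc)‖ ≤ B) →
      ∀ i, ‖scaled₀ X ν i‖ ≤ K * B ∧ ‖W.scaled₁ X i‖ ≤ K * B := by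
  obtain ⟨K, hK, R, hR, h⟩ := W.exists_bound_solution
  refine ⟨K, hK, R, hR, fun ν hν X b B hX h0 h1 hp hq => ?_⟩
  rw [mulVec_A_iff] at hX
  obtain ⟨e0, e1, e2, e3⟩ := hX
  refine h ν hν X B (fun j => W.phase j (W.right j) ν * b (Sum.inl j.succ))
    (fun j => -(W.phase j (W.left j) (-ν) * b (Sum.inr j.castSucc)))
    ⟨e0.trans h0, e3.trans h1⟩ (fun j => ?_) (fun j => ?_) hp (fun j => by rw [norm_neg]; exact hq j)
  · obtain ⟨p1, p2, p3⟩ := W.phase_mul_left_right j ν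
    rw [← e1 j, ← p3]
    simp only [scaled₀, scaled₁, σext_castSucc]
    linear_combination (-(W.σext j.succ : ℂ) ^ 2 * X (Sum.inr j.succ)
            - Complex.I * W.σ j * ν * X (Sum.inl j.succ)) * p1
  · obtain ⟨p1, p2, p3⟩ := W.phase_mul_left_right j ν
    rw [← e2 j, ← p3]
    simp only [scaled₀, scaled₁, σext_castSucc]
    linear_combination (-(W.σ j : ℂ) ^ 2 * X (Sum.inr j.castSucc)
            + Complex.I * W.σ j * ν * X (Sum.inl j.castSucc)) * p2

lemma exists_det_ne_zero (W : Wall n) : ∃ R > 0, ∀ ν ∈ upperSector R, (W.A ν).det ≠ 0 := by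
  obtain ⟨K, hK, R, hR, h⟩ := W.exists_bound_mulVec
  refine ⟨R, hR, fun ν hν hdet => ?_⟩
  obtain ⟨v, hv, hAv⟩ := Matrix.exists_mulVec_eq_zero_iff.2 hdet
  have hb := h ν hν v 0 0 hAv rfl rfl (by simp) (by simp)
  have hν0 : ν ≠ 0 := norm_pos_iff.1 (hR.trans_le hν.2.2)
  refine hv (funext fun i => ?_)
  rcases i with i | i
  · have := (hb i).1
    rw [mul_zero, norm_le_zero_iff, scaled₀] at this
    simpa [hν0] using this
  · have := (hb i).2
    rw [mul_zero, norm_le_zero_iff, scaled₁] at this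
    simpa [(W.σext_pos i).ne'] using this

lemma det_A_neg_ne_zero (W : Wall n) {ν : ℂ} (h : (W.A (-ν)).det ≠ 0) : (W.A ν).det ≠ 0 := by
  intro hdet
  obtain ⟨v, hv, hAv⟩ := Matrix.exists_mulVec_eq_zero_iff.2 hdet
  refine h (Matrix.exists_mulVec_eq_zero_iff.1 ⟨v, hv, ?_⟩)
  exact W.mulVec_A_neg (-ν) v 0 0 rfl (fun _ => rfl) (fun _ => rfl) rfl (by rwa [neg_neg])

/-- In `ℂ⁺`, `û(±ν/σ)` grows no faster than the phase at the far end of the layer. -/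
lemma norm_phase_mul_hat_le (W : Wall n) (j : Fin (n + 1)) {v : ℝ → ℝ}
    (hv : IntervalIntegrable v volume (W.left j) (W.right j)) {ν : ℂ} (hν : 0 ≤ ν.im) :
    ‖W.phase j (W.right j) ν * W.hat j v (ν / W.σ j)‖
        ≤ ∫ y in (W.left j)..(W.right j), |v y| ∧
    ‖W.phase j (W.left j) (-ν) * W.hat j v (-ν / W.σ j)‖
        ≤ ∫ y in (W.left j)..(W.right j), |v y| := by
  have hσ := W.σ_pos j
  have him : ∀ w : ℂ, (-Complex.I * (w / W.σ j)).re = w.im / W.σ j := by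
    intro w
    rw [show -Complex.I * (w / W.σ j) = ((1 / W.σ j : ℝ) : ℂ) * (-Complex.I * w) by
      push_cast; ring, Complex.re_ofReal_mul]
    simp
    ring
  have key : ∀ (w : ℂ) (t : ℝ), W.phase j t w * W.hat j v (w / W.σ j)
      = Complex.exp (-((-Complex.I * (w / W.σ j)) * t)) * ∫ y in (W.left j)..(W.right j),
        Complex.exp ((-Complex.I * (w / W.σ j)) * y) * (v y : ℂ) := by
    intro w t
    rw [hat, phase]
    congr 2
    ring
  constructor
  · rw [key]
    refine norm_exp_mul_expTransform_le (W.left_lt_right j).le hv fun y hy => ?_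
    rw [him]
    exact mul_nonpos_of_nonneg_of_nonpos (div_nonneg hν hσ.le) (by linarith [hy.2])
  · rw [key]
    refine norm_exp_mul_expTransform_le (W.left_lt_right j).le hv fun y hy => ?_
    rw [him, Complex.neg_im]
    exact mul_nonpos_of_nonpos_of_nonneg (div_nonpos_of_nonpos_of_nonneg (by linarith) hσ.le)
      (by linarith [hy.1])

/-- The solution of the system driven by the final-time temperature is holomorphic and at most of
size `|e^{ν² T}|` in the sector, so its contour integrals vanish by Cauchy's theorem. -/
lemma exists_contour_vanish (W : Wall n) : ∃ R₀ > 0, ∀ R ≥ R₀,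
    (∀ ν ∈ upperSector R, (W.A ν).det ≠ 0) ∧
    ∀ (u : Fin (n + 1) → ℝ → ℝ → ℝ) (T : ℝ),
      (∀ j, IntervalIntegrable (fun y => u j y T) volume (W.left j) (W.right j)) →
      ∀ Z : ℂ → Fin (n + 2) ⊕ Fin (n + 2) → ℂ,
      (∀ ν ∈ upperSector R, (W.A ν).mulVec (Z ν) = W.finalVector u T ν) →
      ∀ η > 0, ∀ t ≤ T, ∀ (α τ : ℂ) (i : Fin (n + 2)),
      PlusIntegrable R (contourTerm η t α τ (fun ν => Z ν (Sum.inr i))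
        (fun ν => Z ν (Sum.inl i))) ∧
      plusIntegral R (contourTerm η t α τ (fun ν => Z ν (Sum.inr i))
        (fun ν => Z ν (Sum.inl i))) = 0 := by
  obtain ⟨K, hK, R₁, hR₁, hbd⟩ := W.exists_bound_mulVec
  obtain ⟨R₂, hR₂, hdet⟩ := W.exists_det_ne_zero
  refine ⟨max R₁ R₂, lt_max_of_lt_left hR₁, fun R hR => ?_⟩
  have hmono : ∀ {ρ : ℝ}, ρ ≤ R → ∀ ν ∈ upperSector R, ν ∈ upperSector ρ :=
    fun h ν hν => ⟨hν.1, hν.2.1, h.trans hν.2.2⟩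
  have hR0 : 0 < R := (lt_max_of_lt_left hR₁).trans_le hR
  have hdet' : ∀ ν ∈ upperSector R, (W.A ν).det ≠ 0 := fun ν hν =>
    hdet ν (hmono ((le_max_right _ _).trans hR) ν hν)
  refine ⟨hdet', fun u T hu Z hZ η hη t ht α τ i => ?_⟩
  set M := ∑ j, ∫ y in (W.left j)..(W.right j), |u j y T| with hM
  have hMj : ∀ j, ∫ y in (W.left j)..(W.right j), |u j y T| ≤ M := fun j =>
    Finset.single_le_sum (f := fun j => ∫ y in (W.left j)..(W.right j), |u j y T|)
      (fun j _ => intervalIntegral.integral_nonneg (W.left_lt_right j).le fun y _ => abs_nonneg _)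
      (Finset.mem_univ j)
  have hM0 : 0 ≤ M := Finset.sum_nonneg fun j _ =>
    intervalIntegral.integral_nonneg (W.left_lt_right j).le fun y _ => abs_nonneg _
  have hZb : ∀ ν ∈ upperSector R, ‖scaled₀ (Z ν) ν i‖ ≤ K * (Real.exp ((ν ^ 2).re * T) * M) ∧
      ‖W.scaled₁ (Z ν) i‖ ≤ K * (Real.exp ((ν ^ 2).re * T) * M) := by
    intro ν hν
    have hexp : ‖Complex.exp (ν ^ 2 * T)‖ = Real.exp ((ν ^ 2).re * T) := by
      rw [Complex.norm_exp, Complex.re_mul_ofReal]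
    refine hbd ν (hmono ((le_max_left _ _).trans hR) ν hν) (Z ν) _ _ (hZ ν hν)
      (by simp [finalVector]) (by simp [finalVector]) (fun j => ?_) (fun j => ?_) i
    · have := (W.norm_phase_mul_hat_le j (hu j) hν.2.1).1.trans (hMj j)
      simp only [finalVector, Sum.elim_inl, Fin.cons_succ]
      rw [mul_left_comm, norm_mul, hexp]
      exact mul_le_mul_of_nonneg_left this (Real.exp_pos _).le
    · have := (W.norm_phase_mul_hat_le j (hu j) hν.2.1).2.trans (hMj j)
      simp only [finalVector, Sum.elim_inr, Fin.snoc_castSucc]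
      rw [mul_left_comm, norm_mul, hexp]
      exact mul_le_mul_of_nonneg_left this (Real.exp_pos _).le
  -- Cramer's rule gives the holomorphic representative of `Z`
  set Z' : Fin (n + 2) ⊕ Fin (n + 2) → ℂ → ℂ := fun k ν =>
    ((W.A ν).updateCol k (W.finalVector u T ν)).det / (W.A ν).det with hZ'
  have hZZ' : ∀ k, ∀ ν ∈ upperSector R, Z' k ν = Z ν k := fun k ν hν =>
    (eq_det_updateCol_div (hdet' ν hν) (hZ ν hν) k).symm
  have hZd : ∀ k, ∀ ν ∈ upperSector R, DifferentiableAt ℂ (Z' k) ν := by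
    intro k ν hν
    refine DifferentiableAt.fun_div ?_ ?_ (hdet' ν hν)
    · refine Differentiable.matrix_det (fun a b => ?_) ν
      simp only [Matrix.updateCol_apply]
      split_ifs
      · exact W.differentiable_finalVector hu a
      · exact W.differentiable_A a b
    · exact Differentiable.matrix_det (fun a b => W.differentiable_A a b) ν
  have hcongr : ∀ ν ∈ upperSector R, contourTerm η t α τ (Z' (Sum.inr i)) (Z' (Sum.inl i)) ν
      = contourTerm η t α τ (fun ν => Z ν (Sum.inr i)) (fun ν => Z ν (Sum.inl i)) ν := by
    intro ν hν
    simp only [contourTerm, hZZ' _ ν hν]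
  have main := plusIntegral_eq_zero (F := contourTerm η t α τ (Z' (Sum.inr i)) (Z' (Sum.inl i)))
    (C := (‖α‖ / W.σext i ^ 2 + ‖τ‖) * (K * M)) hR0 (half_pos hη) ?_ ?_
  · exact ⟨main.1.congr hR0 hcongr, (plusIntegral_congr hR0 hcongr).symm.trans main.2⟩
  · intro ν hν
    have h1 := hZd (Sum.inr i) ν hν
    have h2 := hZd (Sum.inl i) ν hν
    unfold contourTerm
    fun_prop
  · intro ν hν
    rw [hcongr ν hν, contourTerm, norm_mul, norm_exp_contour]
    obtain ⟨b0, b1⟩ := hZb ν hν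
    have hs : 0 < W.σext i ^ 2 := pow_pos (W.σext_pos i) 2
    have hre : (ν ^ 2).re ≤ 0 := by rw [sq_re_eq]; linarith [hν.1]
    have c1 : ‖α * Z ν (Sum.inr i) + τ * (Complex.I * ν * Z ν (Sum.inl i))‖
        ≤ (‖α‖ / W.σext i ^ 2 + ‖τ‖) * (K * (Real.exp ((ν ^ 2).re * T) * M)) := by
      refine (norm_add_le _ _).trans ?_
      rw [add_mul, norm_mul, norm_mul]
      refine add_le_add ?_ (mul_le_mul_of_nonneg_left b0 (norm_nonneg τ))
      rw [div_mul_eq_mul_div, le_div_iff₀ hs, mul_assoc]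
      refine mul_le_mul_of_nonneg_left ?_ (norm_nonneg α)
      rw [scaled₁, norm_mul, norm_pow, Complex.norm_real,
        Real.norm_of_nonneg (W.σext_pos i).le] at b1
      linarith
    have c2 : Real.exp (-(η * ν.im)) ≤ Real.exp (-(η / 2 * ‖ν‖)) := by
      refine Real.exp_le_exp.2 (neg_le_neg ?_)
      nlinarith [upperSector_im hν]
    have c3 : Real.exp (-((ν ^ 2).re * t)) * Real.exp ((ν ^ 2).re * T) ≤ 1 := by
      rw [← Real.exp_add, Real.exp_le_one_iff]
      nlinarith
    have hD : 0 ≤ (‖α‖ / W.σext i ^ 2 + ‖τ‖) * (K * M) := by positivity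
    calc Real.exp (-(η * ν.im)) * Real.exp (-((ν ^ 2).re * t)) *
          ‖α * Z ν (Sum.inr i) + τ * (Complex.I * ν * Z ν (Sum.inl i))‖
        ≤ Real.exp (-(η * ν.im)) * Real.exp (-((ν ^ 2).re * t)) *
          ((‖α‖ / W.σext i ^ 2 + ‖τ‖) * (K * (Real.exp ((ν ^ 2).re * T) * M))) := by gcongr
      _ = (‖α‖ / W.σext i ^ 2 + ‖τ‖) * (K * M) * Real.exp (-(η * ν.im)) *
          (Real.exp (-((ν ^ 2).re * t)) * Real.exp ((ν ^ 2).re * T)) := by ring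
      _ ≤ (‖α‖ / W.σext i ^ 2 + ‖τ‖) * (K * M) * Real.exp (-(η / 2 * ‖ν‖)) * 1 := by gcongr
      _ ≤ decay ((‖α‖ / W.σext i ^ 2 + ‖τ‖) * (K * M)) (η / 2) ‖ν‖ := by
          rw [decay, mul_one]
          refine mul_le_mul_of_nonneg_right ?_ (Real.exp_pos _).le
          exact le_mul_of_one_le_right hD (by linarith [norm_nonneg ν])

end Wall

/-! ### The global relation -/

/-- An identity `∂_s v = ∂_y q` between continuous partial derivatives, integrated over a
rectangle. -/
lemma integral_sub_eq_of_partial_eq {v q g : ℝ → ℝ → ℂ} {a b ε T : ℝ} (hab : a ≤ b) (hε : ε ≤ T)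
    (hg : ContinuousOn (Function.uncurry g) (Icc a b ×ˢ Icc ε T))
    (hv : ∀ y ∈ Icc a b, ∀ s ∈ Icc ε T, HasDerivAt (fun s => v y s) (g y s) s)
    (hq : ∀ s ∈ Icc ε T, ∀ y ∈ Icc a b, HasDerivAt (fun y => q y s) (g y s) y) :
    ∫ y in a..b, (v y T - v y ε) = ∫ s in ε..T, (q b s - q a s) := by
  have h1 : ∀ y ∈ Icc a b, v y T - v y ε = ∫ s in ε..T, g y s := by
    intro y hy
    refine (intervalIntegral.integral_eq_sub_of_hasDerivAt (fun s hs => ?_) ?_).symm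
    · rw [uIcc_of_le hε] at hs
      exact hv y hy s hs
    · refine ContinuousOn.intervalIntegrable ?_
      rw [uIcc_of_le hε]
      exact hg.comp (f := fun s => (y, s)) (by fun_prop) fun s hs => ⟨hy, hs⟩
  have h2 : ∀ s ∈ Icc ε T, q b s - q a s = ∫ y in a..b, g y s := by
    intro s hs
    refine (intervalIntegral.integral_eq_sub_of_hasDerivAt (f := fun y => q y s)
      (fun y hy => ?_) ?_).symm
    · rw [uIcc_of_le hab] at hy
      exact hq s hs y hy
    · refine ContinuousOn.intervalIntegrable ?_
      rw [uIcc_of_le hab]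
      exact hg.comp (f := fun y => (y, s)) (by fun_prop) fun y hy => ⟨hy, hs⟩
  rw [intervalIntegral.integral_congr fun y hy => h1 y (by rwa [uIcc_of_le hab] at hy),
    intervalIntegral.integral_congr fun s hs => h2 s (by rwa [uIcc_of_le hε] at hs)]
  rw [intervalIntegral.integral_of_le hab, intervalIntegral.integral_of_le hε]
  simp only [intervalIntegral.integral_of_le hab, intervalIntegral.integral_of_le hε]
  refine integral_integral_swap ?_
  rw [Measure.prod_restrict]
  exact (hg.integrableOn_compact (isCompact_Icc.prod isCompact_Icc)).mono_set
    (prod_mono Ioc_subset_Icc_self Ioc_subset_Icc_self)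

namespace Wall.IsPerfectContactSolution

variable {W : Wall n} {u₀ : Fin (n + 1) → ℝ → ℝ} {f₁ f₂ : ℝ → ℝ} {u : Fin (n + 1) → ℝ → ℝ → ℝ}

lemma continuousOn_slice (h : W.IsPerfectContactSolution u₀ f₁ f₂ u) (j : Fin (n + 1)) {t : ℝ}
    (ht : 0 < t) : ContinuousOn (fun y => u j y t) (Icc (W.left j) (W.right j)) :=
  (h.continuousOn_u j).comp (f := fun y => (y, t)) (by fun_prop) fun _ hy => ⟨hy, ht⟩

lemma intervalIntegrable_slice (h : W.IsPerfectContactSolution u₀ f₁ f₂ u) (j : Fin (n + 1))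
    {t : ℝ} (ht : 0 < t) :
    IntervalIntegrable (fun y => u j y t) volume (W.left j) (W.right j) := by
  refine ContinuousOn.intervalIntegrable ?_
  rw [uIcc_of_le (W.left_lt_right j).le]
  exact h.continuousOn_slice j ht

/-- The flux of `e^{-iky + ωs} u`, whose divergence balances its time derivative when
`ω = σ² k²`. -/
def flux (W : Wall n) (u : Fin (n + 1) → ℝ → ℝ → ℝ) (j : Fin (n + 1)) (k : ℂ) (y s : ℝ) : ℂ :=
  Complex.exp (-Complex.I * k * y + (W.σ j * k) ^ 2 * s) *
    (W.σ j ^ 2 * (W.dx u j y s + Complex.I * k * u j y s))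

lemma continuousOn_flux (h : W.IsPerfectContactSolution u₀ f₁ f₂ u) (j : Fin (n + 1)) (k : ℂ) :
    ContinuousOn (Function.uncurry (flux W u j k)) (Icc (W.left j) (W.right j) ×ˢ Ioi 0) := by
  have h1 := Complex.continuous_ofReal.comp_continuousOn (h.continuousOn_u j)
  have h2 := Complex.continuous_ofReal.comp_continuousOn (h.continuousOn_dx j)
  have h3 : Continuous fun p : ℝ × ℝ =>
    Complex.exp (-Complex.I * k * p.1 + (W.σ j * k) ^ 2 * p.2) := by fun_prop
  exact h3.continuousOn.mul (continuousOn_const.mul (h2.add (continuousOn_const.mul h1)))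

/-- The integrated balance on `[a, b] × [ε, T]`, with `[a, b]` inside the open layer. -/
lemma balance_interior (h : W.IsPerfectContactSolution u₀ f₁ f₂ u) (j : Fin (n + 1)) (k : ℂ)
    {a b ε T : ℝ} (ha : W.left j < a) (hab : a ≤ b) (hb : b < W.right j) (hε : 0 < ε)
    (hεT : ε ≤ T) :
    ∫ y in a..b, (Complex.exp (-Complex.I * k * y + (W.σ j * k) ^ 2 * T) * u j y T
        - Complex.exp (-Complex.I * k * y + (W.σ j * k) ^ 2 * ε) * u j y ε)
      = ∫ s in ε..T, (flux W u j k b s - flux W u j k a s) := by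
  have hy : ∀ y ∈ Icc a b, y ∈ Ioo (W.left j) (W.right j) := fun y hy =>
    ⟨ha.trans_le hy.1, hy.2.trans_lt hb⟩
  have hs : ∀ s ∈ Icc ε T, 0 < s := fun s hs => hε.trans_le hs.1
  refine integral_sub_eq_of_partial_eq
    (v := fun y s => Complex.exp (-Complex.I * k * y + (W.σ j * k) ^ 2 * s) * u j y s)
    (g := fun y s => Complex.exp (-Complex.I * k * y + (W.σ j * k) ^ 2 * s) *
      ((W.σ j * k) ^ 2 * u j y s + deriv (fun s => u j y s) s)) hab hεT ?_ ?_ ?_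
  · have hsub : Icc a b ×ˢ Icc ε T ⊆ Icc (W.left j) (W.right j) ×ˢ Ioi 0 :=
      prod_mono (fun y h => Ioo_subset_Icc_self (hy y h)) hs
    have hsub' : Icc a b ×ˢ Icc ε T ⊆ Ioo (W.left j) (W.right j) ×ˢ Ioi 0 := prod_mono hy hs
    have h1 := Complex.continuous_ofReal.comp_continuousOn ((h.continuousOn_u j).mono hsub)
    have h2 := Complex.continuous_ofReal.comp_continuousOn ((h.continuousOn_time j).mono hsub')
    have h3 : Continuous fun p : ℝ × ℝ =>
      Complex.exp (-Complex.I * k * p.1 + (W.σ j * k) ^ 2 * p.2) := by fun_prop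
    exact h3.continuousOn.mul ((continuousOn_const.mul h1).add h2)
  · intro y hy' s hs'
    have h1 := ((h.differentiableAt_time j y (hy y hy') s (hs s hs')).hasDerivAt).ofReal_comp
    have h2 : HasDerivAt (fun s : ℝ => -Complex.I * k * y + (W.σ j * k : ℂ) ^ 2 * s)
        ((W.σ j * k : ℂ) ^ 2) s := by
      simpa using ((Complex.ofRealCLM.hasDerivAt (x := s)).const_mul
        ((W.σ j * k : ℂ) ^ 2)).const_add (-Complex.I * k * y)
    exact (h2.cexp.mul h1).congr_deriv (by ring)
  · intro s hs' y hy'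
    have hI := hy y hy'
    have h0 : HasDerivAt (fun y => u j y s) (W.dx u j y s) y :=
      ((h.differentiableOn_u j s (hs s hs') y
        (Ioo_subset_Icc_self hI)).hasDerivWithinAt).hasDerivAt (Icc_mem_nhds hI.1 hI.2)
    have h1 := ((h.differentiableAt_dx j y hI s (hs s hs')).hasDerivAt).ofReal_comp
    have h2 : HasDerivAt (fun y : ℝ => -Complex.I * k * y + (W.σ j * k : ℂ) ^ 2 * s)
        (-Complex.I * k) y := by
      simpa using ((Complex.ofRealCLM.hasDerivAt (x := y)).const_mul
        (-Complex.I * k)).add_const ((W.σ j * k : ℂ) ^ 2 * s)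
    have h3 := h2.cexp.mul ((h1.add (h0.ofReal_comp.const_mul (Complex.I * k))).const_mul
      ((W.σ j : ℂ) ^ 2))
    have heat : ((deriv (fun s => u j y s) s : ℝ) : ℂ)
        = (W.σ j : ℂ) ^ 2 * ((deriv (fun z => W.dx u j z s) y : ℝ) : ℂ) := by
      rw [h.heat j y hI s (hs s hs')]
      push_cast
      ring
    refine h3.congr_deriv ?_
    rw [heat]
    simp only [Pi.add_apply]
    linear_combination (-(W.σ j : ℂ) ^ 2 * k ^ 2 * u j y s *
      Complex.exp (-Complex.I * k * y + (W.σ j * k) ^ 2 * s)) * Complex.I_sq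

/-- The balance extended to the closed layer, by continuity of `u` and `u_x` up to its ends. -/
lemma balance_layer (h : W.IsPerfectContactSolution u₀ f₁ f₂ u) (j : Fin (n + 1)) (k : ℂ)
    {ε T : ℝ} (hε : 0 < ε) (hεT : ε ≤ T) :
    Complex.exp ((W.σ j * k) ^ 2 * T) * W.hat j (fun y => u j y T) k
        - Complex.exp ((W.σ j * k) ^ 2 * ε) * W.hat j (fun y => u j y ε) k
      = ∫ s in ε..T, (flux W u j k (W.right j) s - flux W u j k (W.left j) s) := by
  have hlr := W.left_lt_right j
  have hsub : Icc (W.left j) (W.right j) ×ˢ Icc ε T ⊆ Icc (W.left j) (W.right j) ×ˢ Ioi 0 :=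
    prod_mono Subset.rfl fun s hs => hε.trans_le hs.1
  have hfl := (h.continuousOn_flux j k).mono hsub
  have hfy : ∀ y ∈ Icc (W.left j) (W.right j), ContinuousOn (flux W u j k y) (Icc ε T) :=
    fun y hy => hfl.comp (f := fun s => (y, s)) (by fun_prop) fun s hs => ⟨hy, hs⟩
  have hfyi : ∀ y ∈ Icc (W.left j) (W.right j), IntervalIntegrable (flux W u j k y) volume ε T :=
    fun y hy => ContinuousOn.intervalIntegrable (by rw [uIcc_of_le hεT]; exact hfy y hy)
  obtain ⟨C, hC⟩ := (isCompact_Icc.prod isCompact_Icc).exists_bound_of_continuousOn hfl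
  set w : ℝ → ℂ := fun y => Complex.exp (-Complex.I * k * y + (W.σ j * k) ^ 2 * T) * u j y T
        - Complex.exp (-Complex.I * k * y + (W.σ j * k) ^ 2 * ε) * u j y ε with hw
  have hwi : IntervalIntegrable w volume (W.left j) (W.right j) := by
    refine ContinuousOn.intervalIntegrable ?_
    rw [uIcc_of_le hlr.le]
    have h1 := Complex.continuous_ofReal.comp_continuousOn
      (h.continuousOn_slice j (hε.trans_le hεT))
    have h2 := Complex.continuous_ofReal.comp_continuousOn (h.continuousOn_slice j hε)
    have h3 : ∀ t : ℝ, ContinuousOn (fun y : ℝ =>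
        Complex.exp (-Complex.I * k * y + (W.σ j * k) ^ 2 * t)) (Icc (W.left j) (W.right j)) :=
      fun t => by fun_prop
    exact ((h3 T).mul h1).sub ((h3 ε).mul h2)
  have hwsub : ∀ a ∈ Icc (W.left j) (W.right j), ∀ b ∈ Icc (W.left j) (W.right j),
      IntervalIntegrable w volume a b := fun a ha b hb =>
    hwi.mono_set (by rw [uIcc_of_le hlr.le]; exact uIcc_subset_Icc ha hb)
  -- `H` is constant in the open layer and continuous on the closed one
  set H : ℝ → ℂ := fun a => (∫ s in ε..T, flux W u j k a s) - ∫ y in (W.left j)..a, w y with hH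
  have hHc : ContinuousOn H (Icc (W.left j) (W.right j)) := by
    refine ContinuousOn.sub (fun a ha => ?_) ?_
    · refine intervalIntegral.continuousWithinAt_of_dominated_interval (bound := fun _ => C)
        ?_ ?_ intervalIntegrable_const ?_
      · filter_upwards [self_mem_nhdsWithin] with y hy
        exact (hfyi y hy).def'.aestronglyMeasurable
      · filter_upwards [self_mem_nhdsWithin] with y hy
        refine Eventually.of_forall fun s hs => hC (y, s) ⟨hy, ?_⟩
        rw [uIoc_of_le hεT] at hs
        exact Ioc_subset_Icc_self hs
      · refine Eventually.of_forall fun s hs => ?_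
        rw [uIoc_of_le hεT] at hs
        exact hfl.comp (f := fun y => (y, s)) (s := Icc (W.left j) (W.right j)) (by fun_prop)
          (fun y hy => ⟨hy, Ioc_subset_Icc_self hs⟩) a ha
    · have := intervalIntegral.continuousOn_primitive_interval' hwi left_mem_uIcc
      rwa [uIcc_of_le hlr.le] at this
  have hHle : ∀ a b, W.left j < a → a ≤ b → b < W.right j → H a = H b := by
    intro a b ha hab hb
    have ha' : a ∈ Icc (W.left j) (W.right j) := ⟨ha.le, hab.trans hb.le⟩
    have hb' : b ∈ Icc (W.left j) (W.right j) := ⟨ha.le.trans hab, hb.le⟩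
    have hbal := h.balance_interior j k ha hab hb hε hεT
    rw [intervalIntegral.integral_sub (hfyi b hb') (hfyi a ha')] at hbal
    have hadd := intervalIntegral.integral_add_adjacent_intervals
      (hwsub _ ⟨le_rfl, hlr.le⟩ a ha') (hwsub a ha' b hb')
    simp only [hH]
    rw [← hadd]
    linear_combination hbal
  have hHI : EqOn H (fun _ => H ((W.left j + W.right j) / 2)) (Ioo (W.left j) (W.right j)) := by
    intro a ha
    rcases le_total a ((W.left j + W.right j) / 2) with h1 | h1
    · exact hHle a _ ha.1 h1 (by linarith)
    · exact (hHle _ a (by linarith) h1 ha.2).symm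
  have hHcl := hHI.of_subset_closure hHc continuousOn_const Ioo_subset_Icc_self
    (by rw [closure_Ioo hlr.ne])
  have hends : H (W.left j) = H (W.right j) :=
    (hHcl ⟨le_rfl, hlr.le⟩).trans (hHcl ⟨hlr.le, le_rfl⟩).symm
  have hhat : ∀ t : ℝ, 0 < t → Complex.exp ((W.σ j * k) ^ 2 * t) * W.hat j (fun y => u j y t) k
      = ∫ y in (W.left j)..(W.right j),
        Complex.exp (-Complex.I * k * y + (W.σ j * k) ^ 2 * t) * u j y t := by
    intro t _
    rw [Wall.hat, ← intervalIntegral.integral_const_mul]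
    refine intervalIntegral.integral_congr fun y _ => ?_
    simp only [Complex.exp_add]
    ring
  have hint : ∀ t : ℝ, 0 < t → IntervalIntegrable (fun y : ℝ =>
      Complex.exp (-Complex.I * k * y + (W.σ j * k) ^ 2 * t) * (u j y t : ℂ)) volume
      (W.left j) (W.right j) := fun t ht => by
    have := h.intervalIntegrable_slice j ht
    exact IntervalIntegrable.continuousOn_mul (f := fun s => (u j s t : ℂ))
      ⟨this.1.ofReal, this.2.ofReal⟩ (by fun_prop)
  rw [hhat T (hε.trans_le hεT), hhat ε hε, ← intervalIntegral.integral_sub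
    (hint T (hε.trans_le hεT)) (hint ε hε),
    intervalIntegral.integral_sub (hfyi _ ⟨hlr.le, le_rfl⟩) (hfyi _ ⟨le_rfl, hlr.le⟩)]
  simp only [hH, intervalIntegral.integral_same] at hends
  linear_combination hends

lemma intervalIntegrable_flux_end {y T : ℝ} (j : Fin (n + 1)) (k : ℂ)
    (h0 : IntervalIntegrable (fun s => u j y s) volume 0 T)
    (h1 : IntervalIntegrable (fun s => W.dx u j y s) volume 0 T) :
    IntervalIntegrable (flux W u j k y) volume 0 T ∧
    ∫ s in (0 : ℝ)..T, flux W u j k y s = Complex.exp (-Complex.I * k * y) *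
      (W.σ j ^ 2 * (timeTransform (fun s => W.dx u j y s) ((W.σ j * k) ^ 2) T
        + Complex.I * k * timeTransform (fun s => u j y s) ((W.σ j * k) ^ 2) T)) := by
  have i0 := (intervalIntegrable_exp_mul h0 ((W.σ j * k) ^ 2)).const_mul
    (Complex.exp (-Complex.I * k * y) * W.σ j ^ 2 * (Complex.I * k))
  have i1 := (intervalIntegrable_exp_mul h1 ((W.σ j * k) ^ 2)).const_mul
    (Complex.exp (-Complex.I * k * y) * W.σ j ^ 2)
  have e : flux W u j k y = fun s : ℝ =>
      Complex.exp (-Complex.I * k * y) * W.σ j ^ 2 *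
        (Complex.exp ((W.σ j * k) ^ 2 * s) * (W.dx u j y s : ℂ))
      + Complex.exp (-Complex.I * k * y) * W.σ j ^ 2 * (Complex.I * k) *
        (Complex.exp ((W.σ j * k) ^ 2 * s) * (u j y s : ℂ)) := by
    ext s
    rw [flux, Complex.exp_add]
    ring
  rw [e]
  refine ⟨i1.add i0, ?_⟩
  rw [intervalIntegral.integral_add i1 i0, intervalIntegral.integral_const_mul,
    intervalIntegral.integral_const_mul]
  simp only [timeTransform]
  ring

lemma tendsto_hat_initial (h : W.IsPerfectContactSolution u₀ f₁ f₂ u) (j : Fin (n + 1)) (k : ℂ) :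
    Tendsto (fun ε => W.hat j (fun y => u j y ε) k) (𝓝[>] 0) (𝓝 (W.hat j (u₀ j) k)) := by
  have hlr := W.left_lt_right j
  obtain ⟨M, hM⟩ := isCompact_Icc.exists_bound_of_continuousOn (s := Icc (W.left j) (W.right j))
    (f := fun y : ℝ => Complex.exp (-Complex.I * k * y)) (by fun_prop)
  rw [tendsto_iff_norm_sub_tendsto_zero]
  have hlim := (h.initial j).const_mul M
  rw [mul_zero] at hlim
  refine squeeze_zero' (Eventually.of_forall fun _ => norm_nonneg _) ?_ hlim
  filter_upwards [self_mem_nhdsWithin] with ε (hε : 0 < ε)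
  have i1 := h.intervalIntegrable_slice j hε
  have i0 := h.integrable_initial j
  rw [Wall.hat, Wall.hat, ← intervalIntegral.integral_sub (intervalIntegrable_exp_mul i1 _)
    (intervalIntegrable_exp_mul i0 _), ← intervalIntegral.integral_const_mul]
  refine intervalIntegral.norm_integral_le_of_norm_le hlr.le
    (Eventually.of_forall fun y hy => ?_) ((i1.sub i0).abs.const_mul M)
  rw [← mul_sub, norm_mul, ← Complex.ofReal_sub, Complex.norm_real, Real.norm_eq_abs]
  exact mul_le_mul_of_nonneg_right (hM y (Ioc_subset_Icc_self hy)) (abs_nonneg _)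

/-- The global relation of a layer. -/
lemma global_relation (h : W.IsPerfectContactSolution u₀ f₁ f₂ u) (j : Fin (n + 1)) (k : ℂ)
    {T : ℝ} (hT : 0 < T) :
    Complex.exp ((W.σ j * k) ^ 2 * T) * W.hat j (fun y => u j y T) k - W.hat j (u₀ j) k
      = Complex.exp (-Complex.I * k * W.right j) * (W.σ j ^ 2 *
          (timeTransform (fun s => W.dx u j (W.right j) s) ((W.σ j * k) ^ 2) T
          + Complex.I * k * timeTransform (fun s => u j (W.right j) s) ((W.σ j * k) ^ 2) T))
        - Complex.exp (-Complex.I * k * W.left j) * (W.σ j ^ 2 *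
          (timeTransform (fun s => W.dx u j (W.left j) s) ((W.σ j * k) ^ 2) T
          + Complex.I * k * timeTransform (fun s => u j (W.left j) s) ((W.σ j * k) ^ 2) T)) := by
  obtain ⟨ir, er⟩ := intervalIntegrable_flux_end (W := W) j k (h.integrable_right j T hT)
    (h.integrable_dx_right j T hT)
  obtain ⟨il, el⟩ := intervalIntegrable_flux_end (W := W) j k (h.integrable_left j T hT)
    (h.integrable_dx_left j T hT)
  rw [← er, ← el, ← intervalIntegral.integral_sub ir il]
  have hi := ir.sub il
  have hexp : Tendsto (fun ε : ℝ => Complex.exp ((W.σ j * k) ^ 2 * ε)) (𝓝[>] 0) (𝓝 1) := by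
    have : Continuous fun ε : ℝ => Complex.exp ((W.σ j * k : ℂ) ^ 2 * ε) := by fun_prop
    simpa using (this.tendsto 0).mono_left nhdsWithin_le_nhds
  have L := (tendsto_const_nhds (x := Complex.exp ((W.σ j * k) ^ 2 * T) *
    W.hat j (fun y => u j y T) k)).sub (hexp.mul (h.tendsto_hat_initial j k))
  rw [one_mul] at L
  have hprim : Tendsto (fun ε => ∫ s in (0 : ℝ)..ε,
      (flux W u j k (W.right j) s - flux W u j k (W.left j) s)) (𝓝[>] 0) (𝓝 0) := by
    have := intervalIntegral.continuousOn_primitive_interval' hi left_mem_uIcc 0 left_mem_uIcc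
    rw [uIcc_of_le hT.le] at this
    have h2 := this.mono_left (nhdsWithin_mono 0 (Ioc_subset_Icc_self (a := (0 : ℝ)) (b := T)))
    rw [nhdsWithin_Ioc_eq_nhdsGT hT] at h2
    simpa using h2
  have Rl := (tendsto_const_nhds (x := ∫ s in (0 : ℝ)..T,
    (flux W u j k (W.right j) s - flux W u j k (W.left j) s))).sub hprim
  rw [sub_zero] at Rl
  refine tendsto_nhds_unique L (Rl.congr' ?_)
  filter_upwards [Ioc_mem_nhdsGT hT] with ε hε
  rw [h.balance_layer j k hε.1 hε.2, ← intervalIntegral.integral_add_adjacent_intervals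
    (hi.mono_set (uIcc_subset_uIcc left_mem_uIcc (by rw [uIcc_of_le hT.le]; exact ⟨hε.1.le, hε.2⟩)))
    (hi.mono_set (uIcc_subset_uIcc (by rw [uIcc_of_le hT.le]; exact ⟨hε.1.le, hε.2⟩)
      right_mem_uIcc)), add_sub_cancel_left]

end Wall.IsPerfectContactSolution

/-! ### Gaussian regularization of the Fourier inversion -/

open scoped FourierTransform RealInnerProductSpace in
lemma tendsto_integral_gaussian_mul_fourier {f : ℝ → ℂ} (hf : Integrable f) {x : ℝ}
    (hx : ContinuousAt f x) :
    Tendsto (fun c : ℝ => ∫ w : ℝ,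
      Complex.exp (-(c : ℂ)⁻¹ * ‖w‖ ^ 2 + 2 * Real.pi * Complex.I * ⟪x, w⟫) • 𝓕 f w)
      atTop (𝓝 (f x)) := by
  refine (Real.tendsto_integral_gaussian_smul' hf hx).congr' ?_
  filter_upwards [Ioi_mem_atTop 0] with c (hc : 0 < c)
  have J : Integrable (fun w : ℝ =>
      Complex.exp (-(c : ℂ)⁻¹ * ‖w‖ ^ 2 + 2 * Real.pi * Complex.I * ⟪x, w⟫)) :=
    GaussianFourier.integrable_cexp_neg_mul_sq_norm_add (by simpa) _ _
  have h := (VectorFourier.integral_fourierIntegral_smul_eq_flip (L := innerₗ ℝ)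
      Real.continuous_fourierChar continuous_inner J hf)
  have h' : ∫ w : ℝ, 𝓕 (fun w : ℝ =>
      Complex.exp (-(c : ℂ)⁻¹ * ‖w‖ ^ 2 + 2 * Real.pi * Complex.I * ⟪x, w⟫)) w • f w
      = ∫ w : ℝ, Complex.exp (-(c : ℂ)⁻¹ * ‖w‖ ^ 2 + 2 * Real.pi * Complex.I * ⟪x, w⟫) • 𝓕 f w := by
    simpa using! h
  rw [← h']
  congr with w
  rw [fourier_gaussian_innerProductSpace' (by simpa)]
  rw [div_inv_eq_mul, div_inv_eq_mul]
  congr 3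
  ring

/-- Fourier inversion at a point of continuity, with the factor `e^{-σ² k² δ}`, `δ → 0`. -/
lemma tendsto_integral_exp_mul_transform {f : ℝ → ℂ} (hf : Integrable f) {x σ : ℝ} (hσ : 0 < σ)
    (hx : ContinuousAt f x) :
    Tendsto (fun δ : ℝ => ∫ k : ℝ, Complex.exp (Complex.I * k * x - (σ * k) ^ 2 * δ) *
      ∫ y : ℝ, Complex.exp (-Complex.I * k * y) * f y) (𝓝[>] 0) (𝓝 (2 * Real.pi * f x)) := by
  have hc : Tendsto (fun δ : ℝ => (4 * Real.pi ^ 2 * σ ^ 2 * δ)⁻¹) (𝓝[>] 0) atTop := by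
    refine tendsto_inv_nhdsGT_zero.comp (tendsto_nhdsWithin_iff.2 ⟨?_, ?_⟩)
    · have : Continuous fun δ : ℝ => 4 * Real.pi ^ 2 * σ ^ 2 * δ := by fun_prop
      simpa using (this.tendsto 0).mono_left nhdsWithin_le_nhds
    · filter_upwards [self_mem_nhdsWithin] with δ (hδ : 0 < δ)
      have := Real.pi_pos
      exact mem_Ioi.2 (by positivity)
  refine (((tendsto_integral_gaussian_mul_fourier hf hx).comp hc).const_mul
    (2 * Real.pi : ℂ)).congr fun δ => ?_
  have hsub := Measure.integral_comp_mul_left (fun k : ℝ =>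
    Complex.exp (Complex.I * k * x - (σ * k) ^ 2 * δ) *
      ∫ y : ℝ, Complex.exp (-Complex.I * k * y) * f y) (2 * Real.pi)
  have hπ := Real.pi_pos
  have hπ' : (Real.pi : ℂ) ≠ 0 := Complex.ofReal_ne_zero.2 hπ.ne'
  rw [abs_of_pos (by positivity)] at hsub
  rw [eq_comm, ← inv_mul_eq_iff_eq_mul₀ (by simp [hπ'])]
  rw [Complex.real_smul] at hsub
  push_cast at hsub
  rw [← hsub]
  refine integral_congr_ae (Eventually.of_forall fun w => ?_)
  simp only [smul_eq_mul, Real.fourier_eq']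
  congr 1
  · have hw : ((|w| : ℝ) : ℂ) ^ 2 = (w : ℂ) ^ 2 := by
      rw [← Complex.ofReal_pow, sq_abs, Complex.ofReal_pow]
    congr 1
    simp [hw]
    ring
  · refine integral_congr_ae (Eventually.of_forall fun y => ?_)
    beta_reduce
    congr 2
    simp
    ring

/-! ### From the real line to the contours -/

/-- On the rays of `∂D_R⁺` the factor `e^{-ν² δ}` has modulus one, and on the arc it is bounded, so it
can be removed by dominated convergence. -/
lemma PlusIntegrable.tendsto_gaussian {F : ℂ → ℂ} {R : ℝ} (hR : 0 < R) (hF : PlusIntegrable R F) :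
    Tendsto (fun δ : ℝ => plusIntegral R fun ν => Complex.exp (-(ν ^ 2 * δ)) * F ν)
      (𝓝[>] 0) (𝓝 (plusIntegral R F)) := by
  have hπ := Real.pi_pos
  have hpt : ∀ ν : ℂ, Tendsto (fun δ : ℝ => Complex.exp (-(ν ^ 2 * δ)) * F ν) (𝓝[>] 0)
      (𝓝 (F ν)) := by
    intro ν
    have : Continuous fun δ : ℝ => Complex.exp (-(ν ^ 2 * δ)) * F ν := by fun_prop
    simpa using (this.tendsto 0).mono_left nhdsWithin_le_nhds
  have hnorm : ∀ (ν : ℂ) (δ : ℝ), ‖Complex.exp (-(ν ^ 2 * δ))‖ = Real.exp (-((ν ^ 2).re * δ)) := by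
    intro ν δ
    rw [Complex.norm_exp, Complex.neg_re, Complex.re_mul_ofReal]
  have ray : ∀ θ : ℝ, Real.cos (2 * θ) = 0 →
      IntegrableOn (fun r : ℝ => F (r * Complex.exp (θ * Complex.I))) (Ioi R) →
      Tendsto (fun δ : ℝ => ∫ r in Ioi R,
        (Complex.exp (-(((r : ℂ) * Complex.exp (θ * Complex.I)) ^ 2 * δ)) *
          F (r * Complex.exp (θ * Complex.I))) * Complex.exp (θ * Complex.I)) (𝓝[>] 0)
        (𝓝 (∫ r in Ioi R, F (r * Complex.exp (θ * Complex.I)) * Complex.exp (θ * Complex.I))) := by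
    intro θ hθ hi
    refine tendsto_integral_filter_of_dominated_convergence
      (fun r : ℝ => ‖F (r * Complex.exp (θ * Complex.I))‖) ?_ ?_ hi.norm ?_
    · refine Eventually.of_forall fun δ => ?_
      exact ((Continuous.aestronglyMeasurable (by fun_prop)).mul hi.aestronglyMeasurable).mul_const _
    · refine Eventually.of_forall fun δ => Eventually.of_forall fun r => ?_
      rw [norm_mul, norm_mul, hnorm, Complex.norm_exp_ofReal_mul_I, mul_one, sq_re_eq,
        (polar_re_im r θ).1, (polar_re_im r θ).2]
      rw [Real.cos_two_mul'] at hθ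
      rw [show -(((r * Real.cos θ) ^ 2 - (r * Real.sin θ) ^ 2) * δ) = 0 by
        linear_combination -(r ^ 2 * δ) * hθ, Real.exp_zero, one_mul]
    · exact Eventually.of_forall fun r => (hpt _).mul_const _
  have arc : Tendsto (fun δ : ℝ => ∫ θ in (3 * Real.pi / 4)..(Real.pi / 4),
        (Complex.exp (-(((R : ℂ) * Complex.exp (θ * Complex.I)) ^ 2 * δ)) *
          F (R * Complex.exp (θ * Complex.I))) * (R * Complex.I * Complex.exp (θ * Complex.I)))
        (𝓝[>] 0) (𝓝 (∫ θ in (3 * Real.pi / 4)..(Real.pi / 4),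
          F (R * Complex.exp (θ * Complex.I)) * (R * Complex.I * Complex.exp (θ * Complex.I)))) := by
    have hi := hF.2.2.symm
    refine intervalIntegral.tendsto_integral_filter_of_dominated_convergence
      (fun θ : ℝ => Real.exp (R ^ 2) * ‖F (R * Complex.exp (θ * Complex.I))‖ * R) ?_ ?_
      ((hi.norm.const_mul _).mul_const _) ?_
    · refine Eventually.of_forall fun δ => ?_
      exact ((Continuous.aestronglyMeasurable (by fun_prop)).mul
        hi.def'.aestronglyMeasurable).mul (Continuous.aestronglyMeasurable (by fun_prop))
    · filter_upwards [Ioc_mem_nhdsGT one_pos] with δ hδ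
      refine Eventually.of_forall fun θ _ => ?_
      rw [norm_mul, norm_mul, hnorm, norm_mul, norm_mul, Complex.norm_exp_ofReal_mul_I,
        Complex.norm_I, Complex.norm_real, Real.norm_of_nonneg hR.le, mul_one, mul_one]
      gcongr
      have h1 := Complex.abs_re_le_norm (((R : ℂ) * Complex.exp (θ * Complex.I)) ^ 2)
      rw [norm_pow, norm_mul_exp_mul_I hR.le] at h1
      have h2 := neg_abs_le (((R : ℂ) * Complex.exp (θ * Complex.I)) ^ 2).re
      nlinarith [hδ.1, hδ.2, sq_nonneg R]
    · exact Eventually.of_forall fun θ _ => (hpt _).mul_const _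
  refine ((ray _ ?_ hF.2.1).neg.add arc).add (ray _ ?_ hF.1)
  · rw [show 2 * (3 * Real.pi / 4) = Real.pi / 2 + Real.pi by ring, Real.cos_add_pi,
      Real.cos_pi_div_two, neg_zero]
  · rw [show 2 * (Real.pi / 4) = Real.pi / 2 by ring, Real.cos_pi_div_two]

/-- The transforms of traces `φ₁, φ₀` over `(a, b)`, as functions of `ν`. -/
def sqTransform (φ : ℝ → ℝ) (a b : ℝ) (ν : ℂ) : ℂ :=
  ∫ s in a..b, Complex.exp (ν ^ 2 * s) * (φ s : ℂ)

lemma differentiable_sqTransform {φ : ℝ → ℝ} {a b : ℝ} (h : IntervalIntegrable φ volume a b) :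
    Differentiable ℂ (sqTransform φ a b) := by
  have h1 : Differentiable ℂ fun w : ℂ => ∫ s in a..b, Complex.exp (w * s) * (φ s : ℂ) := by
    simpa using differentiable_expTransform h 1
  exact h1.comp (f := fun ν : ℂ => ν ^ 2) (by fun_prop)

/-- The part of the traces before time `t`: the regularized integral over the real line tends to
the integral over `∂D_R⁺`. -/
lemma tendsto_integral_contourTerm_past {φ₁ φ₀ : ℝ → ℝ} {R η t : ℝ} (hR : 0 < R) (hη : 0 < η)
    (ht : 0 ≤ t) (h₁ : IntervalIntegrable φ₁ volume 0 t) (h₀ : IntervalIntegrable φ₀ volume 0 t)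
    (α τ : ℂ) :
    (∀ δ > 0, Integrable fun k : ℝ =>
      contourTerm η (t + δ) α τ (sqTransform φ₁ 0 t) (sqTransform φ₀ 0 t) k) ∧
    PlusIntegrable R (contourTerm η t α τ (sqTransform φ₁ 0 t) (sqTransform φ₀ 0 t)) ∧
    Tendsto (fun δ : ℝ => ∫ k : ℝ,
      contourTerm η (t + δ) α τ (sqTransform φ₁ 0 t) (sqTransform φ₀ 0 t) k) (𝓝[>] 0)
      (𝓝 (plusIntegral R (contourTerm η t α τ (sqTransform φ₁ 0 t) (sqTransform φ₀ 0 t)))) := by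
  have d₁ := differentiable_sqTransform h₁
  have d₀ := differentiable_sqTransform h₀
  set B₁ := ∫ s in (0 : ℝ)..t, |φ₁ s|
  set B₀ := ∫ s in (0 : ℝ)..t, |φ₀ s|
  have hb : ∀ ν : ℂ, 0 ≤ (ν ^ 2).re → ‖Complex.exp (-(ν ^ 2 * t)) * sqTransform φ₁ 0 t ν‖ ≤ B₁ ∧
      ‖Complex.exp (-(ν ^ 2 * t)) * sqTransform φ₀ 0 t ν‖ ≤ B₀ := fun ν hν =>
    ⟨norm_exp_mul_expTransform_le ht h₁ fun s hs =>
        mul_nonpos_of_nonneg_of_nonpos hν (by linarith [hs.2]),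
      norm_exp_mul_expTransform_le ht h₀ fun s hs =>
        mul_nonpos_of_nonneg_of_nonpos hν (by linarith [hs.2])⟩
  have hP : PlusIntegrable R (contourTerm η t α τ (sqTransform φ₁ 0 t) (sqTransform φ₀ 0 t)) := by
    refine plusIntegrable_of_decay hR (half_pos hη) (differentiable_contourTerm d₁ d₀).continuous
      (C := ‖α‖ * B₁ + ‖τ‖ * B₀) fun ν hν hre => ?_
    obtain ⟨b₁, b₀⟩ := hb ν hre.ge
    refine norm_contourTerm_le (t' := t) ?_ b₁ b₀
    rw [sub_self, mul_zero, neg_zero, Real.exp_zero, mul_one]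
    refine Real.exp_le_exp.2 (neg_le_neg ?_)
    nlinarith [upperSector_im hν]
  have hL : ∀ δ > 0, (Integrable fun k : ℝ =>
      contourTerm η (t + δ) α τ (sqTransform φ₁ 0 t) (sqTransform φ₀ 0 t) k) ∧ ∫ k : ℝ,
      contourTerm η (t + δ) α τ (sqTransform φ₁ 0 t) (sqTransform φ₀ 0 t) k
      = plusIntegral R
        (contourTerm η (t + δ) α τ (sqTransform φ₁ 0 t) (sqTransform φ₀ 0 t)) := by
    intro δ hδ
    have hc : 0 < min (η / 2) (δ * R / 2) := lt_min (by positivity) (by positivity)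
    refine integral_real_eq_plusIntegral hR hc (C := ‖α‖ * B₁ + ‖τ‖ * B₀)
      (differentiable_contourTerm d₁ d₀) fun r hr θ hθ => ?_
    have hr0 : 0 ≤ r := hR.le.trans hr
    obtain ⟨s1, s2⟩ := polar_side hr0 hθ
    have hn := norm_mul_exp_mul_I hr0 θ
    set ν : ℂ := (r : ℂ) * Complex.exp (θ * Complex.I)
    have hre : 0 ≤ (ν ^ 2).re := by rw [sq_re_eq]; linarith
    obtain ⟨b₁, b₀⟩ := hb ν hre
    have := norm_contourTerm_le (η := η) (t := t + δ) (α := α) (τ := τ)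
      (c := min (η / 2) (δ * R / 2)) (t' := t) ?_ b₁ b₀
    · rwa [hn] at this
    · rw [add_sub_cancel_left, ← Real.exp_add, hn]
      refine Real.exp_le_exp.2 ?_
      have hsq : ν.re ^ 2 + ν.im ^ 2 = r ^ 2 := by
        have := Complex.sq_norm ν
        rw [Complex.normSq_apply, hn] at this
        linarith
      rw [sq_re_eq] at hre ⊢
      -- near the real axis the Gaussian factor decays, away from it the factor `e^{iνη}` does
      by_cases hcase : r / 2 ≤ ν.im
      · have : min (η / 2) (δ * R / 2) * r ≤ η / 2 * r :=
          mul_le_mul_of_nonneg_right (min_le_left _ _) hr0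
        nlinarith [mul_nonneg hre hδ.le]
      · have : min (η / 2) (δ * R / 2) * r ≤ δ * R / 2 * r :=
          mul_le_mul_of_nonneg_right (min_le_right _ _) hr0
        have h2 : r * R / 2 ≤ ν.re ^ 2 - ν.im ^ 2 := by nlinarith
        nlinarith [mul_le_mul_of_nonneg_left h2 hδ.le, mul_nonneg hη.le s2]
  refine ⟨fun δ hδ => (hL δ hδ).1, hP, (hP.tendsto_gaussian hR).congr' ?_⟩
  filter_upwards [self_mem_nhdsWithin] with δ (hδ : 0 < δ)
  rw [(hL δ hδ).2]
  congr 1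
  ext ν
  rw [contourTerm, contourTerm, ← mul_assoc, ← Complex.exp_add]
  congr 2
  push_cast
  ring

/-- The part of the traces after time `t` does not contribute, by Cauchy's theorem in `D_R⁺`. -/
lemma contourTerm_future {φ₁ φ₀ : ℝ → ℝ} {R η t T : ℝ} (hR : 0 < R) (hη : 0 < η) (ht : t ≤ T)
    (h₁ : IntervalIntegrable φ₁ volume t T) (h₀ : IntervalIntegrable φ₀ volume t T) (α τ : ℂ) :
    PlusIntegrable R (contourTerm η t α τ (sqTransform φ₁ t T) (sqTransform φ₀ t T)) ∧
    plusIntegral R (contourTerm η t α τ (sqTransform φ₁ t T) (sqTransform φ₀ t T)) = 0 := by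
  refine plusIntegral_eq_zero hR (half_pos hη)
    (C := ‖α‖ * (∫ s in t..T, |φ₁ s|) + ‖τ‖ * ∫ s in t..T, |φ₀ s|)
    (fun ν _ => differentiable_contourTerm (differentiable_sqTransform h₁)
      (differentiable_sqTransform h₀) ν) fun ν hν => ?_
  have hre : (ν ^ 2).re ≤ 0 := by rw [sq_re_eq]; linarith [hν.1]
  refine norm_contourTerm_le (t' := t) ?_
    (norm_exp_mul_expTransform_le ht h₁ fun s hs =>
      mul_nonpos_of_nonpos_of_nonneg hre (by linarith [hs.1]))
    (norm_exp_mul_expTransform_le ht h₀ fun s hs =>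
      mul_nonpos_of_nonpos_of_nonneg hre (by linarith [hs.1]))
  rw [sub_self, mul_zero, neg_zero, Real.exp_zero, mul_one]
  refine Real.exp_le_exp.2 (neg_le_neg ?_)
  nlinarith [upperSector_im hν]

/-- The regularized integral over the real line of a boundary term at time `t` tends to the contour
integral in which the traces are transformed up to any later time `T`. -/
lemma tendsto_integral_contourTerm {φ₁ φ₀ : ℝ → ℝ} {R η t T : ℝ} (hR : 0 < R) (hη : 0 < η)
    (ht : t ∈ Ioc 0 T) (h₁ : IntervalIntegrable φ₁ volume 0 T)
    (h₀ : IntervalIntegrable φ₀ volume 0 T) (α τ : ℂ) :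
    (∀ δ > 0, Integrable fun k : ℝ =>
      contourTerm η (t + δ) α τ (sqTransform φ₁ 0 t) (sqTransform φ₀ 0 t) k) ∧
    PlusIntegrable R (contourTerm η t α τ (sqTransform φ₁ 0 T) (sqTransform φ₀ 0 T)) ∧
    Tendsto (fun δ : ℝ => ∫ k : ℝ,
      contourTerm η (t + δ) α τ (sqTransform φ₁ 0 t) (sqTransform φ₀ 0 t) k) (𝓝[>] 0)
      (𝓝 (plusIntegral R (contourTerm η t α τ (sqTransform φ₁ 0 T) (sqTransform φ₀ 0 T)))) := by
  have hmem : t ∈ uIcc 0 T := by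
    rw [uIcc_of_le (ht.1.le.trans ht.2)]
    exact ⟨ht.1.le, ht.2⟩
  have past : ∀ {φ : ℝ → ℝ}, IntervalIntegrable φ volume 0 T → IntervalIntegrable φ volume 0 t :=
    fun h => h.mono_set (uIcc_subset_uIcc left_mem_uIcc hmem)
  have future : ∀ {φ : ℝ → ℝ}, IntervalIntegrable φ volume 0 T →
      IntervalIntegrable φ volume t T :=
    fun h => h.mono_set (uIcc_subset_uIcc hmem right_mem_uIcc)
  obtain ⟨i1, i2, i3⟩ := tendsto_integral_contourTerm_past hR hη ht.1.le (past h₁) (past h₀) α τ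
  obtain ⟨j1, j2⟩ := contourTerm_future hR hη ht.2 (future h₁) (future h₀) (-α) (-τ)
  have hadd : ∀ {φ : ℝ → ℝ}, IntervalIntegrable φ volume 0 T → ∀ ν,
      sqTransform φ 0 T ν = sqTransform φ 0 t ν + sqTransform φ t T ν := fun h ν =>
    (intervalIntegral.integral_add_adjacent_intervals (intervalIntegrable_exp_mul (past h) _)
      (intervalIntegrable_exp_mul (future h) _)).symm
  have e : contourTerm η t α τ (sqTransform φ₁ 0 T) (sqTransform φ₀ 0 T) = fun ν =>
      contourTerm η t α τ (sqTransform φ₁ 0 t) (sqTransform φ₀ 0 t) ν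
        - contourTerm η t (-α) (-τ) (sqTransform φ₁ t T) (sqTransform φ₀ t T) ν := by
    ext ν
    simp only [contourTerm]
    rw [hadd h₁, hadd h₀]
    ring
  rw [e]
  refine ⟨i1, i2.sub j1, ?_⟩
  rw [plusIntegral_sub i2 j1, j2, sub_zero]
  exact i3

/-! ### The solution formula -/

namespace Wall.IsPerfectContactSolution

variable {W : Wall n} {u₀ : Fin (n + 1) → ℝ → ℝ} {f₁ f₂ : ℝ → ℝ} {u : Fin (n + 1) → ℝ → ℝ → ℝ}

lemma timeTransform_congr {f g : ℝ → ℝ} {T : ℝ} (hT : 0 ≤ T) (h : ∀ t > 0, f t = g t) (ω : ℂ) :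
    timeTransform f ω T = timeTransform g ω T := by
  refine intervalIntegral.integral_congr_ae (Eventually.of_forall fun s hs => ?_)
  rw [uIoc_of_le hT] at hs
  rw [h s hs.1]

lemma timeTransform_add_mul {f g : ℝ → ℝ} {T : ℝ} (hf : IntervalIntegrable f volume 0 T)
    (hg : IntervalIntegrable g volume 0 T) (a b : ℝ) (ω : ℂ) :
    timeTransform (fun t => a * f t + b * g t) ω T
      = a * timeTransform f ω T + b * timeTransform g ω T := by
  simp only [timeTransform]
  rw [← intervalIntegral.integral_const_mul, ← intervalIntegral.integral_const_mul,
    ← intervalIntegral.integral_add ((intervalIntegrable_exp_mul hf _).const_mul _)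
      ((intervalIntegrable_exp_mul hg _).const_mul _)]
  refine intervalIntegral.integral_congr fun s _ => ?_
  push_cast
  ring

/-- By perfect contact, the unknowns at the right end of layer `j` are the traces of `u j` there. -/
lemma traceTransforms_succ (h : W.IsPerfectContactSolution u₀ f₁ f₂ u) {T : ℝ} (hT : 0 < T)
    (ν : ℂ) (j : Fin (n + 1)) :
    W.traceTransforms u T ν (Sum.inl j.succ)
        = timeTransform (fun s => u j (W.right j) s) (ν ^ 2) T ∧
    (W.σext j.succ : ℂ) ^ 2 * W.traceTransforms u T ν (Sum.inr j.succ)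
        = (W.σ j : ℂ) ^ 2 * timeTransform (fun s => W.dx u j (W.right j) s) (ν ^ 2) T := by
  induction j using Fin.lastCases with
  | last =>
    rw [Fin.succ_last, σext_last]
    simp [traceTransforms]
  | cast i =>
    rw [Fin.succ_castSucc, σext_castSucc]
    simp only [traceTransforms, Sum.elim_inl, Sum.elim_inr, Fin.snoc_castSucc]
    refine ⟨timeTransform_congr hT.le (fun t ht => (h.contact_u i t ht).symm) _, ?_⟩
    simp only [timeTransform]
    rw [← intervalIntegral.integral_const_mul, ← intervalIntegral.integral_const_mul]
    refine intervalIntegral.integral_congr_ae (Eventually.of_forall fun s hs => ?_)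
    rw [uIoc_of_le hT.le] at hs
    have := congrArg (fun r : ℝ => (r : ℂ)) (h.contact_flux i s hs.1)
    push_cast at this
    linear_combination (-Complex.exp (ν ^ 2 * s)) * this

lemma traceTransforms_castSucc (T : ℝ) (ν : ℂ) (j : Fin (n + 1)) :
    W.traceTransforms u T ν (Sum.inl j.castSucc)
        = timeTransform (fun s => u j (W.left j) s) (ν ^ 2) T ∧
    W.traceTransforms u T ν (Sum.inr j.castSucc)
        = timeTransform (fun s => W.dx u j (W.left j) s) (ν ^ 2) T := by
  simp [traceTransforms]

/-- The transforms of the traces solve the linear system: the rows are the boundary conditions and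
the global relations at `k = ± ν / σ_j`. -/
lemma mulVec_traceTransforms (h : W.IsPerfectContactSolution u₀ f₁ f₂ u) {T : ℝ} (hT : 0 < T)
    (ν : ℂ) : (W.A ν).mulVec (W.traceTransforms u T ν)
      = W.finalVector u T ν + W.dataVector u₀ f₁ f₂ T ν := by
  rw [mulVec_A_iff]
  have hph : ∀ (j : Fin (n + 1)) (p : ℝ) (w : ℂ),
      Complex.exp (-Complex.I * (w / W.σ j) * p) = W.phase j p (-w) := by
    intro j p w
    rw [phase]
    congr 1
    ring
  refine ⟨?_, fun j => ?_, fun j => ?_, ?_⟩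
  · have e := (timeTransform_congr hT.le h.boundary_left (ν ^ 2)).symm.trans
      (timeTransform_add_mul (h.integrable_left 0 T hT) (h.integrable_dx_left 0 T hT) _ _ _)
    have t := traceTransforms_castSucc (W := W) (u := u) T ν 0
    rw [Fin.castSucc_zero] at t
    rw [t.1, t.2, ← e]
    simp [finalVector, dataVector]
  · obtain ⟨t1, t2⟩ := h.traceTransforms_succ hT ν j
    obtain ⟨t3, t4⟩ := traceTransforms_castSucc (W := W) (u := u) T ν j
    have hσ := W.σ_ne j
    have g := h.global_relation j (ν / W.σ j) hT
    rw [mul_div_cancel₀ _ hσ, hph, hph] at g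
    rw [t2, t1, t3, t4]
    simp only [Pi.add_apply, finalVector, dataVector, Sum.elim_inl, Fin.cons_succ]
    rw [← sub_eq_add_neg, g]
    field_simp
  · obtain ⟨t1, t2⟩ := h.traceTransforms_succ hT ν j
    obtain ⟨t3, t4⟩ := traceTransforms_castSucc (W := W) (u := u) T ν j
    have hσ := W.σ_ne j
    have g := h.global_relation j (-ν / W.σ j) hT
    rw [mul_div_cancel₀ _ hσ, hph, hph, neg_neg, neg_sq] at g
    rw [t2, t1, t3, t4]
    simp only [Pi.add_apply, finalVector, dataVector, Sum.elim_inr, Fin.snoc_castSucc]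
    rw [← sub_eq_add_neg, g]
    field_simp
    ring
  · have e := (timeTransform_congr hT.le h.boundary_right (ν ^ 2)).symm.trans
      (timeTransform_add_mul (h.integrable_right (Fin.last n) T hT)
        (h.integrable_dx_right (Fin.last n) T hT) _ _ _)
    simp [finalVector, dataVector, traceTransforms, e]

/-- The integral of the initial datum converges, and the Gaussian regularization is harmless. -/
lemma integrable_initialIntegrand (h : W.IsPerfectContactSolution u₀ f₁ f₂ u) (j : Fin (n + 1))
    (y : ℝ) {t : ℝ} (ht : 0 < t) :
    Integrable (W.initialIntegrand u₀ j y t) ∧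
    Tendsto (fun δ => ∫ k : ℝ, W.initialIntegrand u₀ j y (t + δ) k) (𝓝[>] 0)
      (𝓝 (∫ k : ℝ, W.initialIntegrand u₀ j y t k)) := by
  have hσ := W.σ_pos j
  have hi := h.integrable_initial j
  have hcont : ∀ t : ℝ, Continuous (W.initialIntegrand u₀ j y t) := by
    intro t
    have h1 : Continuous fun k : ℝ => W.hat j (u₀ j) k :=
      (W.differentiable_hat j hi).continuous.comp Complex.continuous_ofReal
    unfold initialIntegrand
    fun_prop
  have hexp : ∀ (k t : ℝ), ‖Complex.exp (Complex.I * k * y - ((W.σ j : ℂ) * k) ^ 2 * t)‖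
      = Real.exp (-(W.σ j ^ 2 * t) * k ^ 2) := by
    intro k t
    rw [Complex.norm_exp]
    congr 1
    rw [← Complex.ofReal_mul, ← Complex.ofReal_pow, ← Complex.ofReal_mul, Complex.sub_re,
      Complex.ofReal_re, mul_assoc, ← Complex.ofReal_mul]
    simp
    ring
  have hint : Integrable (W.initialIntegrand u₀ j y t) := by
    refine Integrable.mono' ((integrable_exp_neg_mul_sq (b := W.σ j ^ 2 * t)
      (by positivity)).mul_const (∫ y in (W.left j)..(W.right j), |u₀ j y|))
      (hcont t).aestronglyMeasurable (Eventually.of_forall fun k => ?_)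
    rw [initialIntegrand, norm_mul, hexp]
    refine mul_le_mul_of_nonneg_left ?_ (Real.exp_pos _).le
    have := norm_exp_mul_expTransform_le (t := 0) (w := -Complex.I * k) (W.left_lt_right j).le hi
      (fun s _ => by simp)
    simpa [Wall.hat] using this
  refine ⟨hint, ?_⟩
  refine tendsto_integral_filter_of_dominated_convergence
    (fun k => ‖W.initialIntegrand u₀ j y t k‖) (Eventually.of_forall fun δ =>
      (hcont _).aestronglyMeasurable) ?_ hint.norm (Eventually.of_forall fun k => ?_)
  · filter_upwards [self_mem_nhdsWithin] with δ (hδ : 0 < δ)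
    refine Eventually.of_forall fun k => ?_
    rw [initialIntegrand, initialIntegrand, norm_mul, norm_mul, hexp, hexp]
    refine mul_le_mul_of_nonneg_right (Real.exp_le_exp.2 ?_) (norm_nonneg _)
    nlinarith [mul_nonneg (mul_nonneg (sq_nonneg (W.σ j)) hδ.le) (sq_nonneg k)]
  · have : Continuous fun δ : ℝ => W.initialIntegrand u₀ j y (t + δ) k := by
      unfold initialIntegrand
      fun_prop
    simpa using (this.tendsto 0).mono_left nhdsWithin_le_nhds

/-- The temperature as a limit of regularized inverse Fourier integrals. -/
lemma tendsto_regularized (h : W.IsPerfectContactSolution u₀ f₁ f₂ u) (j : Fin (n + 1))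
    {x t : ℝ} (hx : x ∈ Ioo (W.left j) (W.right j)) (ht : 0 < t) :
    Tendsto (fun δ : ℝ => ∫ k : ℝ, Complex.exp (Complex.I * k * x - (W.σ j * k) ^ 2 * δ) *
      W.hat j (fun y => u j y t) k) (𝓝[>] 0) (𝓝 (2 * Real.pi * (u j x t : ℂ))) := by
  have hlr := W.left_lt_right j
  have hc := h.continuousOn_slice j ht
  set f : ℝ → ℂ := (Ioc (W.left j) (W.right j)).indicator fun y => (u j y t : ℂ) with hf
  have hfi : Integrable f := by
    rw [hf, integrable_indicator_iff measurableSet_Ioc]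
    exact ((h.intervalIntegrable_slice j ht).1).ofReal
  have hfe : f =ᶠ[𝓝 x] fun y => (u j y t : ℂ) := by
    filter_upwards [Ioo_mem_nhds hx.1 hx.2] with y hy
    exact indicator_of_mem (Ioo_subset_Ioc_self hy) _
  have hfx : ContinuousAt f x := by
    rw [continuousAt_congr hfe]
    exact Complex.continuous_ofReal.continuousAt.comp
      (hc.continuousAt (Icc_mem_nhds hx.1 hx.2))
  have key := tendsto_integral_exp_mul_transform hfi (W.σ_pos j) hfx
  rw [hfe.eq_of_nhds] at key
  refine key.congr fun δ => integral_congr_ae (Eventually.of_forall fun k => ?_)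
  beta_reduce
  congr 1
  rw [Wall.hat, intervalIntegral.integral_of_le hlr.le, ← integral_indicator measurableSet_Ioc]
  refine integral_congr_ae (Eventually.of_forall fun y => ?_)
  simp only [hf, indicator]
  split_ifs <;> simp

/-- The solution formula with the actual traces. -/
lemma represents_traceTransforms (h : W.IsPerfectContactSolution u₀ f₁ f₂ u) {R T : ℝ}
    (hR : 0 < R) (hT : 0 < T) : W.Represents R T u₀ (W.traceTransforms u T) u := by
  intro j x hx t ht
  have hσ := W.σ_pos j
  have hσ' := W.σ_ne j
  have hηl : 0 < (x - W.left j) / W.σ j := div_pos (sub_pos.2 hx.1) hσ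
  have hηr : 0 < (W.right j - x) / W.σ j := div_pos (sub_pos.2 hx.2) hσ
  obtain ⟨i0, l0⟩ := h.integrable_initialIntegrand j x ht.1
  obtain ⟨il, jl, ll⟩ := tendsto_integral_contourTerm hR hηl ht (h.integrable_dx_left j T hT)
    (h.integrable_left j T hT) (W.σ j) 1
  obtain ⟨ir, jr, lr⟩ := tendsto_integral_contourTerm hR hηr ht (h.integrable_dx_right j T hT)
    (h.integrable_right j T hT) (W.σ j) (-1)
  have el : W.plusIntegrand (W.traceTransforms u T) j x t
      = contourTerm ((x - W.left j) / W.σ j) t (W.σ j) 1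
        (sqTransform (fun s => W.dx u j (W.left j) s) 0 T)
        (sqTransform (fun s => u j (W.left j) s) 0 T) := by
    rw [plusIntegrand_eq]
    congr 1 <;> ext ν
    · exact (traceTransforms_castSucc T ν j).2
    · exact (traceTransforms_castSucc T ν j).1
  have er : (fun ν => W.minusIntegrand (W.traceTransforms u T) j x t (-ν))
      = contourTerm ((W.right j - x) / W.σ j) t (W.σ j) (-1)
        (sqTransform (fun s => W.dx u j (W.right j) s) 0 T)
        (sqTransform (fun s => u j (W.right j) s) 0 T) := by
    rw [minusIntegrand_neg_eq]
    ext ν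
    obtain ⟨t1, t2⟩ := h.traceTransforms_succ hT (-ν) j
    rw [neg_sq] at t1 t2
    have t3 : (W.σext j.succ : ℂ) ^ 2 / W.σ j * W.traceTransforms u T (-ν) (Sum.inr j.succ)
        = W.σ j * sqTransform (fun s => W.dx u j (W.right j) s) 0 T ν := by
      rw [div_mul_eq_mul_div, t2, timeTransform, sqTransform]
      field_simp
    simp only [contourTerm]
    rw [t3, t1]
    rfl
  refine ⟨i0, ?_, ?_, ?_⟩
  · rw [minusIntegrable_iff, er]; exact jr
  · rw [el]; exact jl
  · rw [minusIntegral_eq, er, el]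
    have hsplit : ∀ δ : ℝ, 0 < δ → ∫ k : ℝ, Complex.exp (Complex.I * k * x - (W.σ j * k) ^ 2 * δ) *
        W.hat j (fun y => u j y t) k
        = (∫ k : ℝ, W.initialIntegrand u₀ j x (t + δ) k)
          + (∫ k : ℝ, contourTerm ((W.right j - x) / W.σ j) (t + δ) (W.σ j) (-1)
            (sqTransform (fun s => W.dx u j (W.right j) s) 0 t)
            (sqTransform (fun s => u j (W.right j) s) 0 t) k)
          - ∫ k : ℝ, contourTerm ((x - W.left j) / W.σ j) (t + δ) (W.σ j) 1
            (sqTransform (fun s => W.dx u j (W.left j) s) 0 t)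
            (sqTransform (fun s => u j (W.left j) s) 0 t) k := by
      intro δ hδ
      obtain ⟨i0', -⟩ := h.integrable_initialIntegrand j x (add_pos ht.1 hδ)
      -- the substitutions `ν = σ k` at the left end and `ν = -σ k` at the right end
      have subst : ∀ (F : ℂ → ℂ) (s : ℝ), |s| = W.σ j → Integrable (fun k : ℝ => F k) →
          Integrable (fun k : ℝ => (W.σ j : ℂ) * F (s * k)) ∧
          ∫ k : ℝ, (W.σ j : ℂ) * F (s * k) = ∫ k : ℝ, F k := by
        intro F s hs hF
        have hs0 : s ≠ 0 := abs_pos.1 (hs ▸ hσ)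
        have e := Measure.integral_comp_mul_left (fun k : ℝ => F k) s
        have i := (hF.comp_mul_left' hs0).const_mul (W.σ j : ℂ)
        simp only [Complex.ofReal_mul] at e i
        refine ⟨i, ?_⟩
        rw [integral_const_mul, e, abs_inv, hs, Complex.real_smul, Complex.ofReal_inv,
          ← mul_assoc, mul_inv_cancel₀ hσ', one_mul]
      obtain ⟨sr1, sr2⟩ := subst _ (-W.σ j) (by rw [abs_neg, abs_of_pos hσ]) (ir δ hδ)
      obtain ⟨sl1, sl2⟩ := subst _ (W.σ j) (abs_of_pos hσ) (il δ hδ)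
      rw [← sr2, ← sl2, ← integral_add' i0' sr1, ← integral_sub (i0'.add sr1) sl1]
      refine integral_congr_ae (Eventually.of_forall fun k => ?_)
      have g := h.global_relation j k ht.1
      simp only [Pi.add_apply, initialIntegrand, contourTerm]
      have e1 : Complex.exp (Complex.I * k * x - (W.σ j * k) ^ 2 * δ)
          = Complex.exp (Complex.I * k * x - (W.σ j * k) ^ 2 * ((t + δ : ℝ) : ℂ)) *
            Complex.exp ((W.σ j * k) ^ 2 * t) := by
        rw [← Complex.exp_add]
        congr 1
        push_cast
        ring
      have e2 : Complex.exp (Complex.I * (((-W.σ j : ℝ) : ℂ) * k) *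
            (((W.right j - x) / W.σ j : ℝ) : ℂ)
            - (((-W.σ j : ℝ) : ℂ) * k) ^ 2 * ((t + δ : ℝ) : ℂ))
          = Complex.exp (Complex.I * k * x - (W.σ j * k) ^ 2 * ((t + δ : ℝ) : ℂ)) *
            Complex.exp (-Complex.I * k * W.right j) := by
        rw [← Complex.exp_add]
        congr 1
        push_cast
        field_simp
        ring
      have e3 : Complex.exp (Complex.I * ((W.σ j : ℂ) * k) * (((x - W.left j) / W.σ j : ℝ) : ℂ)
            - ((W.σ j : ℂ) * k) ^ 2 * ((t + δ : ℝ) : ℂ))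
          = Complex.exp (Complex.I * k * x - (W.σ j * k) ^ 2 * ((t + δ : ℝ) : ℂ)) *
            Complex.exp (-Complex.I * k * W.left j) := by
        rw [← Complex.exp_add]
        congr 1
        push_cast
        field_simp
        ring
      have q : ∀ φ : ℝ → ℝ, timeTransform φ (((W.σ j : ℂ) * k) ^ 2) t
          = sqTransform φ 0 t ((W.σ j : ℂ) * k) := fun _ => rfl
      have q' : ∀ φ : ℝ → ℝ, sqTransform φ 0 t (((-W.σ j : ℝ) : ℂ) * k)
          = sqTransform φ 0 t ((W.σ j : ℂ) * k) := by
        intro φ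
        rw [sqTransform, sqTransform, Complex.ofReal_neg, neg_mul, neg_sq]
      simp only [q] at g
      rw [e1, e2, e3, q', q', Complex.ofReal_neg]
      linear_combination
        Complex.exp (Complex.I * k * x - (W.σ j * k) ^ 2 * ((t + δ : ℝ) : ℂ)) * g
    have lim := (l0.add lr).sub ll
    have heq := tendsto_nhds_unique (h.tendsto_regularized j hx ht.1) (lim.congr' (by
      filter_upwards [self_mem_nhdsWithin] with δ (hδ : 0 < δ)
      exact (hsplit δ hδ).symm))
    have hπ : (Real.pi : ℂ) ≠ 0 := Complex.ofReal_ne_zero.2 Real.pi_pos.ne'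
    have : (u j x t : ℂ) = 1 / (2 * Real.pi) * (2 * Real.pi * (u j x t : ℂ)) := by
      field_simp
    rw [this, heq]
    ring

end Wall.IsPerfectContactSolution

/-- Subtracting from the unknowns a vector that contributes nothing preserves the representation. -/
lemma Wall.Represents.sub {W : Wall n} {R T : ℝ} {u₀ : Fin (n + 1) → ℝ → ℝ}
    {X Z : ℂ → Fin (n + 2) ⊕ Fin (n + 2) → ℂ} {u : Fin (n + 1) → ℝ → ℝ → ℝ}
    (hX : W.Represents R T u₀ X u) (hZ : W.NoContribution R T Z) :
    W.Represents R T u₀ (fun ν => X ν - Z ν) u := by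
  intro j y hy t ht
  obtain ⟨i0, im, ip, e⟩ := hX j y hy t ht
  obtain ⟨zm, zp, em, ep⟩ := hZ j y hy t ht
  have dm : W.minusIntegrand (fun ν => X ν - Z ν) j y t
      = fun ν => W.minusIntegrand X j y t ν - W.minusIntegrand Z j y t ν := by
    ext ν
    simp only [minusIntegrand, Pi.sub_apply]
    ring
  have dp : W.plusIntegrand (fun ν => X ν - Z ν) j y t
      = fun ν => W.plusIntegrand X j y t ν - W.plusIntegrand Z j y t ν := by
    ext ν
    simp only [plusIntegrand, Pi.sub_apply]
    ring
  rw [minusIntegrable_iff] at im zm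
  rw [minusIntegral_eq, neg_eq_zero] at em
  rw [dm, dp, minusIntegrable_iff, minusIntegral_eq]
  refine ⟨i0, im.sub zm, ip.sub zp, ?_⟩
  rw [plusIntegral_sub ip zp, ep, sub_zero, e, minusIntegral_eq, plusIntegral_sub im zm, em,
    sub_zero]

end Multilayer

end

open Multilayer in
theorem mainTheorem2 {n : ℕ} (W : Wall n) :
    ∃ R₀ > 0, ∀ R ≥ R₀,
      (∀ ν ∈ closure (DPlus R) ∪ closure (DMinus R), (W.A ν).det ≠ 0) ∧
      ∀ (u₀ : Fin (n + 1) → ℝ → ℝ) (f₁ f₂ : ℝ → ℝ) (u : Fin (n + 1) → ℝ → ℝ → ℝ),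
        W.IsPerfectContactSolution u₀ f₁ f₂ u → ∀ T > 0,
          (∀ ν, (W.A ν).mulVec (W.traceTransforms u T ν) =
            W.finalVector u T ν + W.dataVector u₀ f₁ f₂ T ν) ∧
          W.Represents R T u₀ (W.traceTransforms u T) u ∧
          (∀ X : ℂ → Fin (n + 2) ⊕ Fin (n + 2) → ℂ,
            (∀ ν ∈ closure (DPlus R) ∪ closure (DMinus R),
              (W.A ν).mulVec (X ν) = W.dataVector u₀ f₁ f₂ T ν) →
            W.Represents R T u₀ X u) ∧
          (∀ Z : ℂ → Fin (n + 2) ⊕ Fin (n + 2) → ℂ,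
            (∀ ν ∈ closure (DPlus R) ∪ closure (DMinus R),
              (W.A ν).mulVec (Z ν) = W.finalVector u T ν) →
            W.NoContribution R T Z) := by
  obtain ⟨R₀, hR₀, main⟩ := W.exists_contour_vanish
  refine ⟨R₀, hR₀, fun R hR => ?_⟩
  have hR0 : 0 < R := hR₀.trans_le hR
  obtain ⟨hdet, hvanish⟩ := main R hR
  have hup : ∀ {ν : ℂ}, ν ∈ upperSector R → ν ∈ closure (DPlus R) ∪ closure (DMinus R) :=
    fun hν => Or.inl (by rwa [closure_DPlus hR0])
  have hlow : ∀ {ν : ℂ}, ν ∈ upperSector R → -ν ∈ closure (DPlus R) ∪ closure (DMinus R) :=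
    fun hν => Or.inr (by rwa [mem_closure_DMinus hR0, neg_neg])
  refine ⟨?_, fun u₀ f₁ f₂ u h T hT => ?_⟩
  · rintro ν (hν | hν)
    · rw [closure_DPlus hR0] at hν
      exact hdet ν hν
    · rw [mem_closure_DMinus hR0] at hν
      exact W.det_A_neg_ne_zero (hdet _ hν)
  have hno : ∀ Z : ℂ → Fin (n + 2) ⊕ Fin (n + 2) → ℂ,
      (∀ ν ∈ closure (DPlus R) ∪ closure (DMinus R),
        (W.A ν).mulVec (Z ν) = W.finalVector u T ν) → W.NoContribution R T Z := by
    intro Z hZ j y hy t ht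
    have hu := fun j => h.intervalIntegrable_slice j hT
    have hηl : 0 < (y - W.left j) / W.σ j := div_pos (sub_pos.2 hy.1) (W.σ_pos j)
    have hηr : 0 < (W.right j - y) / W.σ j := div_pos (sub_pos.2 hy.2) (W.σ_pos j)
    have p := hvanish u T hu Z (fun ν hν => hZ ν (hup hν)) _ hηl t ht.2 (W.σ j) 1 j.castSucc
    have m := hvanish u T hu (fun ν => Z (-ν))
      (fun ν hν => W.mulVec_A_neg_finalVector (hZ _ (hlow hν))) _ hηr t ht.2
      ((W.σext j.succ : ℂ) ^ 2 / W.σ j) (-1) j.succ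
    rw [← W.minusIntegrand_neg_eq Z] at m
    rw [← W.plusIntegrand_eq Z] at p
    rw [minusIntegrable_iff, minusIntegral_eq, m.2, neg_zero]
    exact ⟨m.1, p.1, rfl, p.2⟩
  have hrep := h.represents_traceTransforms hR0 hT
  refine ⟨fun ν => h.mulVec_traceTransforms hT ν, hrep, fun X hX => ?_, hno⟩
  have hdiff := hno (fun ν => W.traceTransforms u T ν - X ν) fun ν hν => by
    rw [Matrix.mulVec_sub, h.mulVec_traceTransforms hT, hX ν hν, add_sub_cancel_right]
  have := hrep.sub hdiff
  simpa only [sub_sub_cancel] using this
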